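/- Let $\varphi_0:\mathbb R^n\to\mathbb R$ and $\Phi:\mathbb R^n\to\mathbb R^m$ be $\mathcal C^2$-smooth around $\bar x\in\mathbb R^n$, let $\theta:\mathbb R^m\to(-\infty,\infty]$ be convex piecewise linear ($\theta\in CPWL$), i.e. its epigraph is a convex polyhedron in $\mathbb R^{m+1}$, let $\bar z:=\Phi(\bar x)$ satisfy $\theta(\bar z)<\infty$, and let $\bar v\in\mathbb R^m$. Consider the composite problem $$\text{minimize }\ \varphi_0(x)+\theta(\Phi(x)),\quad x\in\mathbb R^n,\qquad (P)$$ with the Lagrangian $L(x,v):=\varphi_0(x)+\langle\Phi(x),v\rangle$. Let $\partial\theta$ be the subdifferential of convex analysis (empty where $\theta=\infty$), let $$\Lambda_{\rm com}(\bar x):=\{v\in\mathbb R^m\mid \nabla_xL(\bar x,v)=0,\ v\in\partial\theta(\bar z)\}$$ be the set of Lagrange multipliers of $(P)$ at $\bar x$, and let $$S_{\rm KKT}(p_1,p_2):=\{(x,v)\in\mathbb R^n\times\mathbb R^m\mid p_1=\nabla_xL(x,v),\ v\in\partial\theta(\Phi(x)+p_2)\},\quad (p_1,p_2)\in\mathbb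 R^n\times\mathbb R^m,$$ be the solution map of the canonically perturbed KKT system. Denote by $T(z;\Omega)$ the Bouligand tangent cone to a set $\Omega$ at $z\in\Omega$: the set of all limits of sequences $\alpha_k(z_k-z)$ with $\alpha_k\ge0$, $z_k\in\Omega$ and $z_k\to z$. With $\operatorname{dom}\theta:=\{z\mid\theta(z)<\infty\}$ and the subderivative $d\theta(\bar z)(w):=\liminf_{u\to w,\,t\downarrow0}\frac{\theta(\bar z+tu)-\theta(\bar z)}{t}$, define the critical cone $$\mathcal K(\bar z,\bar v):=\{w\in T(\bar z;\operatorname{dom}\theta)\mid \langle\bar v,w\rangle=d\theta(\bar z)(w)\}.$$ The second-order sufficient condition (SOSC) at $(\bar x,\bar v)$ is $$\langle\nabla^2_{xx}L(\bar x,\bar v)u,u\rangle>0\ \text{ for all } u\ne0 \text{ with } \nabla\Phi(\bar x)u\in\mathcal K(\bar z,\bar v).$$ A multiplier $\bar v\in\Lambda_{\rm com}(\bar x)$ is noncritical if $\xi=0$ is the only $\xi\in\mathbb R^n$ with $$0\in\nabla^2_{xx}L(\bar x,\bar v)\xi+\nabla\Phi(\bar x)^*(D\partial\theta)(\bar z,\bar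 v)(\nabla\Phi(\bar x)\xi),$$ where $(D\partial\theta)(\bar z,\bar v)(u):=\{w\mid(u,w)\in T((\bar z,\bar v);\operatorname{gph}\partial\theta)\}$ is the graphical derivative of $\partial\theta$. A set-valued mapping $F$ is isolatedly calm at $(\bar p,\bar q)$ if $\bar q\in F(\bar p)$ and there are $\ell\ge0$ and neighborhoods $U$ of $\bar p$ and $V$ of $\bar q$ such that $\|q-\bar q\|\le\ell\|p-\bar p\|$ for all $p\in U$ and $q\in F(p)\cap V$. It is robustly isolatedly calm at $(\bar p,\bar q)$ if, in addition, $F(p)\cap V\ne\emptyset$ for all $p\in U$. Theorem. The following are equivalent: (i) $S_{\rm KKT}$ is robustly isolatedly calm at $((0,0),(\bar x,\bar v))$, and $\bar x$ is a local minimizer of $(P)$. (ii) The SOSC holds at $(\bar x,\bar v)$, and $\Lambda_{\rm com}(\bar x)=\{\bar v\}$. (iii) $\Lambda_{\rm com}(\bar x)=\{\bar v\}$, $\bar x$ is a local minimizer of $(P)$, and $\bar v$ is noncritical. (iv) $S_{\rm KKT}$ is isolatedly calm at $((0,0),(\bar x,\bar v))$, and $\bar x$ is a local minimizer of $(P)$.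 -/

import Mathlib

open Filter Topology
open scoped NNReal RealInnerProductSpace

namespace CompositeOpt

noncomputable section

/-! ### Set-valued mappings -/

/-- The graph of a set-valued mapping. -/
def gph {X Y : Type*} (F : X → Set Y) : Set (X × Y) := {p | p.2 ∈ F p.1}

/-- Isolated calmness of `F` at a point `(x, y)` of its graph: there are `ℓ ≥ 0` and neighborhoods
`U` of `x` and `V` of `y` with `F(x') ∩ V ⊆ {y} + ℓ ‖x' - x‖ 𝔹` for all `x' ∈ U`. -/
def IsolatedlyCalmAt {X Y : Type*} [NormedAddCommGroup X] [NormedAddCommGroup Y]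
    (F : X → Set Y) (x : X) (y : Y) : Prop :=
  (x, y) ∈ gph F ∧ ∃ ℓ : ℝ, 0 ≤ ℓ ∧ ∃ U ∈ 𝓝 x, ∃ V ∈ 𝓝 y,
    ∀ x' ∈ U, F x' ∩ V ⊆ Metric.closedBall y (ℓ * ‖x' - x‖)

/-- Robust isolated calmness: isolated calmness with the additional requirement that
`F(x') ∩ V` is nonempty for all `x' ∈ U`. -/
def RobustlyIsolatedlyCalmAt {X Y : Type*} [NormedAddCommGroup X] [NormedAddCommGroup Y]
    (F : X → Set Y) (x : X) (y : Y) : Prop :=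
  (x, y) ∈ gph F ∧ ∃ ℓ : ℝ, 0 ≤ ℓ ∧ ∃ U ∈ 𝓝 x, ∃ V ∈ 𝓝 y,
    ∀ x' ∈ U, F x' ∩ V ⊆ Metric.closedBall y (ℓ * ‖x' - x‖) ∧ (F x' ∩ V).Nonempty

/-- The graphical derivative `DF(x, y)(u) = {w | (u, w) ∈ T((x, y); gph F)}`, where `T` is the
Bouligand-Severi tangent cone (limits of `α_k (z_k - z)` with `α_k ≥ 0` and `z_k → z` in the set;
this is Mathlib's `tangentConeAt` with scalars in `ℝ≥0`). -/
def graphDeriv {X Y : Type*} [NormedAddCommGroup X] [NormedSpace ℝ X]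
    [NormedAddCommGroup Y] [NormedSpace ℝ Y] (F : X → Set Y) (x : X) (y : Y) (u : X) : Set Y :=
  {w | (u, w) ∈ tangentConeAt ℝ≥0 (gph F) (x, y)}

/-! ### Convex piecewise linear functions -/

/-- A convex polyhedron: the intersection of finitely many closed half-spaces. -/
def IsConvexPolyhedron {E : Type*} [AddCommGroup E] [Module ℝ E] (S : Set E) : Prop :=
  ∃ (k : ℕ) (f : Fin k → (E →ₗ[ℝ] ℝ)) (b : Fin k → ℝ), S = {x | ∀ i, f i x ≤ b i}

/-- The effective domain of an extended-real-valued function. -/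
def effDom {Y : Type*} (θ : Y → EReal) : Set Y := {z | θ z < ⊤}

/-- The epigraph of an extended-real-valued function. -/
def epi {Y : Type*} (θ : Y → EReal) : Set (Y × ℝ) := {p | θ p.1 ≤ (p.2 : EReal)}

/-- Convex piecewise linear functions with values in `(-∞, ∞]`: the epigraph is a convex
polyhedron. -/
structure IsCPWL {Y : Type*} [AddCommGroup Y] [Module ℝ Y] (θ : Y → EReal) : Prop where
  ne_bot : ∀ z, θ z ≠ ⊥
  epi_polyhedron : IsConvexPolyhedron (epi θ)

section Inner

variable {X Y : Type*} [NormedAddCommGroup X] [InnerProductSpace ℝ X] [CompleteSpace X]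
  [NormedAddCommGroup Y] [InnerProductSpace ℝ Y] [CompleteSpace Y]

/-- The subdifferential of convex analysis (empty outside the effective domain). -/
def subdiff (θ : Y → EReal) (z : Y) : Set Y :=
  {v | z ∈ effDom θ ∧ ∀ w, θ z + ((⟪v, w - z⟫ : ℝ) : EReal) ≤ θ w}

/-- The Dini-Hadamard subderivative
`dθ(z)(w) = liminf_{u → w, t ↓ 0} (θ(z + t u) - θ(z)) / t`. -/
def subderiv (θ : Y → EReal) (z w : Y) : EReal :=
  liminf (fun p : Y × ℝ => (θ (z + p.2 • p.1) - θ z) / ((p.2 : ℝ) : EReal)) (𝓝 w ×ˢ 𝓝[>] (0 : ℝ))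

/-- The critical cone `K(z, v) = {w ∈ T(z; dom θ) | ⟨v, w⟩ = dθ(z)(w)}` of `θ`. -/
def criticalCone (θ : Y → EReal) (z v : Y) : Set Y :=
  {w | w ∈ tangentConeAt ℝ≥0 (effDom θ) z ∧ ((⟪v, w⟫ : ℝ) : EReal) = subderiv θ z w}

/-! ### Multipliers of the variational system `Ψ(x, v) = 0`, `v ∈ ∂θ(Φ(x))` -/

/-- The set of Lagrange multipliers `Λ(x)` of the variational system. -/
def multipliers (Ψ : X → Y → X) (Φ : X → Y) (θ : Y → EReal) (x : X) : Set Y :=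
  {v | Ψ x v = 0 ∧ v ∈ subdiff θ (Φ x)}

/-- A multiplier `v ∈ Λ(x)` is critical if the generalized equation
`0 ∈ ∇ₓΨ(x, v) ξ + ∇Φ(x)^* (D∂θ)(Φ(x), v)(∇Φ(x) ξ)` has a solution `ξ ≠ 0`. -/
def IsCriticalMultiplier (Ψ : X → Y → X) (Φ : X → Y) (θ : Y → EReal) (x : X) (v : Y) : Prop :=
  v ∈ multipliers Ψ Φ θ x ∧ ∃ ξ : X, ξ ≠ 0 ∧
    ∃ η ∈ graphDeriv (subdiff θ) (Φ x) v (fderiv ℝ Φ x ξ),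
      0 = fderiv ℝ (fun x' => Ψ x' v) x ξ + ContinuousLinearMap.adjoint (fderiv ℝ Φ x) η

/-- A multiplier `v ∈ Λ(x)` is noncritical if it is not critical. -/
def IsNoncriticalMultiplier (Ψ : X → Y → X) (Φ : X → Y) (θ : Y → EReal) (x : X) (v : Y) : Prop :=
  v ∈ multipliers Ψ Φ θ x ∧ ¬ IsCriticalMultiplier Ψ Φ θ x v

/-! ### Composite optimization: minimize `φ₀(x) + θ(Φ(x))` -/

/-- The objective of the composite problem. -/
def objective (φ₀ : X → ℝ) (Φ : X → Y) (θ : Y → EReal) (x : X) : EReal :=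
  (φ₀ x : EReal) + θ (Φ x)

/-- The Lagrangian `L(x, v) = φ₀(x) + ⟨Φ(x), v⟩`. -/
def lagrangian (φ₀ : X → ℝ) (Φ : X → Y) (x : X) (v : Y) : ℝ := φ₀ x + ⟪Φ x, v⟫

/-- The partial gradient `∇ₓL(x, v)`. -/
def gradLagrangian (φ₀ : X → ℝ) (Φ : X → Y) (x : X) (v : Y) : X :=
  gradient (fun x' => lagrangian φ₀ Φ x' v) x

/-- The partial Hessian `∇²ₓₓL(x, v)`. -/
def hessLagrangian (φ₀ : X → ℝ) (Φ : X → Y) (x : X) (v : Y) : X →L[ℝ] X :=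
  fderiv ℝ (fun x' => gradLagrangian φ₀ Φ x' v) x

/-- The set of Lagrange multipliers `{v | ∇ₓL(x, v) = 0, v ∈ ∂θ(Φ(x))}` of the composite
problem. -/
def multipliersCom (φ₀ : X → ℝ) (Φ : X → Y) (θ : Y → EReal) (x : X) : Set Y :=
  {v | gradLagrangian φ₀ Φ x v = 0 ∧ v ∈ subdiff θ (Φ x)}

/-- The second-order sufficient condition at `(x, v)`: `⟨∇²ₓₓL(x, v) u, u⟩ > 0` for all `u ≠ 0`
with `∇Φ(x) u ∈ K(Φ(x), v)`. -/
def SOSC (φ₀ : X → ℝ) (Φ : X → Y) (θ : Y → EReal) (x : X) (v : Y) : Prop :=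
  ∀ u : X, u ≠ 0 → fderiv ℝ Φ x u ∈ criticalCone θ (Φ x) v →
    0 < ⟪hessLagrangian φ₀ Φ x v u, u⟫

/-- The solution map of the canonically perturbed KKT system
`p₁ = ∇ₓL(x, v)`, `v ∈ ∂θ(Φ(x) + p₂)`. -/
def solutionMapKKT (φ₀ : X → ℝ) (Φ : X → Y) (θ : Y → EReal) (p : X × Y) : Set (X × Y) :=
  {q | p.1 = gradLagrangian φ₀ Φ q.1 q.2 ∧ q.2 ∈ subdiff θ (Φ q.1 + p.2)}

end Inner

end

end CompositeOpt

namespace CompositeOpt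

/-! ### Preliminaries -/

/-! Subtracting the linear form of the multiplier and recentering turns `θ` into a function with
polyhedral epigraph `E` and minimum 0 at the origin. What remains is the pair of `E` and `ψ = L(·,
v)`, with `ψ` stationary at `x₀` and `H` its Hessian there. Among the inequalities cutting out `E`,
those active at the origin are homogeneous and the others have slack, so the critical cone is the
polyhedral cone `activeCone` (`criticalCone_eq_activeCone`).

The four conditions are linked in a cycle. (i) ⇒ (iv) drops nonemptiness.

(iv) ⇒ (iii): multipliers form a convex set, so a second one would give unperturbed solutions
arbitrarily close to `v`. A critical direction gives approximate solutions at distance of order `t`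
with residual `o(t)`, against calmness (`eq_zero_of_calm`).

(iii) ⇒ (ii): penalizing the constraint violation by a small multiple of its norm plus a large
multiple of its square yields the second-order necessary condition (`exists_penalty_bound`,
`inner_hess_nonneg`). If the quadratic form of `H` vanishes at some critical `u ≠ 0`, then `u`
minimizes it over the critical directions, and Farkas' lemma turns the first-order condition there
into criticality of the multiplier (`inner_hess_pos_of_noncritical`).

(ii) ⇒ (i): if calmness failed, rescaling would produce a unit solution of the linearized system,
which SOSC and uniqueness of the multiplier exclude (`exists_calm_of_sosc`). SOSC also makes `x₀` a
strict minimizer of a problem penalized by the norm itself (`eventually_eq_of_penalized_le`).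
Minimizers of its perturbed smoothings have small multipliers, which forces exact feasibility in the
limit and solves the perturbed system (`eventually_exists_stationary`).

Both penalty arguments rest on `tendsto_multiplier`: uniqueness of the multiplier forces approximate
multipliers to converge. -/

/-- **Farkas' lemma** for finitely many linear functionals. -/
theorem exists_nonneg_sum_of_farkas {V ι : Type*} [AddCommGroup V] [Module ℝ V]
    (s : Finset ι) (a : ι → V →ₗ[ℝ] ℝ) (f : V →ₗ[ℝ] ℝ)
    (h : ∀ x, (∀ i ∈ s, a i x ≤ 0) → f x ≤ 0) :
    ∃ ν : ι → ℝ, (∀ i, 0 ≤ ν i) ∧ f = ∑ i ∈ s, ν i • a i := by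
  classical
  induction s using Finset.induction_on generalizing a f with
  | empty =>
    refine ⟨0, fun _ => le_rfl, ?_⟩
    ext x
    have h1 := h x (by simp)
    have h2 := h (-x) (by simp)
    simp only [map_neg] at h2
    simp only [Finset.sum_empty, LinearMap.zero_apply]
    linarith
  | insert j s hj ih =>
    by_cases hf : ∀ x, (∀ i ∈ s, a i x ≤ 0) → f x ≤ 0
    · obtain ⟨ν, hν, rfl⟩ := ih a f hf
      refine ⟨Function.update ν j 0, fun i => ?_, ?_⟩
      · by_cases hij : i = j
        · subst hij; simp
        · simp [hij, hν i]
      · rw [Finset.sum_insert hj]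
        simp only [Function.update_self, zero_smul, zero_add]
        refine Finset.sum_congr rfl fun i hi => ?_
        rw [Function.update_of_ne (ne_of_mem_of_not_mem hi hj)]
    · push Not at hf
      obtain ⟨x₀, hx₀, hfx₀⟩ := hf
      have hjx : 0 < a j x₀ := by
        by_contra hc
        have := h x₀ (by
          intro i hi
          rcases Finset.mem_insert.1 hi with rfl | hi
          · exact not_lt.1 hc
          · exact hx₀ i hi)
        linarith
      -- The corrected functionals vanish at `x₀`, hence only see the projection of `x` onto the
      -- kernel of `a j` along `x₀`, where `h` applies.
      obtain ⟨ν, hν, hsum⟩ := ih (fun i => a i - (a i x₀ / a j x₀) • a j)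
        (f - (f x₀ / a j x₀) • a j) (by
          intro x hx
          have := h (x - (a j x / a j x₀) • x₀) (by
            intro i hi
            rcases Finset.mem_insert.1 hi with rfl | hi
            · simp only [map_sub, map_smul, smul_eq_mul]
              rw [div_mul_cancel₀ _ hjx.ne']; simp
            · have := hx i hi
              simp only [LinearMap.sub_apply, LinearMap.smul_apply, smul_eq_mul, map_sub,
                map_smul] at this ⊢
              calc _ = a i x - a i x₀ / a j x₀ * a j x := by ring
                _ ≤ 0 := this)
          simp only [LinearMap.sub_apply, LinearMap.smul_apply, smul_eq_mul, map_sub,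
            map_smul] at this ⊢
          calc _ = f x - a j x / a j x₀ * f x₀ := by ring
            _ ≤ 0 := this)
      have hle : ∑ i ∈ s, ν i * a i x₀ ≤ 0 :=
        Finset.sum_nonpos fun i hi => mul_nonpos_of_nonneg_of_nonpos (hν i) (hx₀ i hi)
      refine ⟨Function.update ν j ((f x₀ - ∑ i ∈ s, ν i * a i x₀) / a j x₀), fun i => ?_, ?_⟩
      · by_cases hij : i = j
        · subst hij
          rw [Function.update_self]
          exact div_nonneg (by linarith) hjx.le
        · simp [hij, hν i]
      · rw [Finset.sum_insert hj, Function.update_self,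
          Finset.sum_congr rfl (g := fun i => ν i • a i) fun i hi => by
            rw [Function.update_of_ne (ne_of_mem_of_not_mem hi hj)]]
        ext x
        have := LinearMap.congr_fun hsum x
        simp only [LinearMap.sub_apply, LinearMap.smul_apply, smul_eq_mul, LinearMap.sum_apply,
          LinearMap.add_apply, mul_sub, Finset.sum_sub_distrib] at this ⊢
        have h2 : ∑ i ∈ s, ν i * (a i x₀ / a j x₀ * a j x)
            = (∑ i ∈ s, ν i * a i x₀) / a j x₀ * a j x := by
          rw [Finset.sum_div, Finset.sum_mul]
          exact Finset.sum_congr rfl fun i _ => by ring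
        rw [h2] at this
        rw [sub_div, sub_mul]
        linarith

/-- Limits along an ultrafilter replace the extraction of subsequences in the compactness arguments.
-/
theorem exists_tendsto_of_eventually_mem {α Z : Type*} [TopologicalSpace Z] (𝒰 : Ultrafilter α)
    {K : Set Z} (hK : IsCompact K) {f : α → Z} (h : ∀ᶠ a in (𝒰 : Filter α), f a ∈ K) :
    ∃ z ∈ K, Tendsto f 𝒰 (𝓝 z) := by
  obtain ⟨z, hz, hle⟩ := hK.ultrafilter_le_nhds (𝒰.map f)
    (le_principal_iff.2 h)
  exact ⟨z, hz, hle⟩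

/-- If a property fails frequently, it fails eventually along some finer ultrafilter. -/
theorem exists_ultrafilter_of_not_eventually {α : Type*} {l : Filter α} {p : α → Prop}
    (h : ¬ ∀ᶠ a in l, p a) :
    ∃ 𝒰 : Ultrafilter α, (𝒰 : Filter α) ≤ l ∧ ∀ᶠ a in (𝒰 : Filter α), ¬ p a := by
  have : (l ⊓ 𝓟 {a | ¬ p a}).NeBot := frequently_iff_neBot.1 (not_eventually.1 h)
  refine ⟨Ultrafilter.of (l ⊓ 𝓟 {a | ¬ p a}), (Ultrafilter.of_le _).trans inf_le_left, ?_⟩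
  exact (Ultrafilter.of_le _).trans inf_le_right (mem_principal_self _)

/-! ### The penalty function and the first-order remainder. -/

section Normed

variable {X Y : Type*} [NormedAddCommGroup X] [NormedSpace ℝ X] [NormedAddCommGroup Y]

/-- A penalty on the constraint violation: a smoothed multiple of the norm plus a multiple of its
square. -/
noncomputable def penalty (ε C σ : ℝ) (u : Y) : ℝ := ε * √(‖u‖ ^ 2 + σ ^ 2) + C * ‖u‖ ^ 2

theorem continuous_penalty (ε C σ : ℝ) : Continuous (penalty ε C σ : Y → ℝ) := by
  unfold penalty; fun_prop

theorem tendsto_penalty {α : Type*} {m : Filter α} {u : α → Y} {σ : α → ℝ} {u₀ : Y} {σ₀ : ℝ}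
    (hu : Tendsto u m (𝓝 u₀)) (hσ : Tendsto σ m (𝓝 σ₀)) (ε C : ℝ) :
    Tendsto (fun k => penalty ε C (σ k) (u k)) m (𝓝 (penalty ε C σ₀ u₀)) :=
  (((hu.norm.pow 2).add (hσ.pow 2)).sqrt.const_mul ε).add ((hu.norm.pow 2).const_mul C)

variable [NormedSpace ℝ Y]

/-- Quadratic remainder estimate of the first-order expansion. -/
theorem isBigO_firstOrder {Φ : X → Y} {A : X → X →L[ℝ] Y} {x₀ : X}
    (hΦ : ∀ᶠ x in 𝓝 x₀, HasFDerivAt Φ (A x) x) (hA : DifferentiableAt ℝ A x₀) :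
    (fun x => Φ x - Φ x₀ - A x₀ (x - x₀)) =O[𝓝 x₀] fun x => ‖x - x₀‖ ^ 2 := by
  obtain ⟨M, hM⟩ := hA.hasFDerivAt.isBigO_sub.bound
  obtain ⟨r, hr, hball⟩ := Metric.eventually_nhds_iff_ball.1 (hΦ.and hM)
  refine Asymptotics.IsBigO.of_bound |M| ?_
  filter_upwards [Metric.ball_mem_nhds x₀ hr] with x hx
  have hsub : Metric.closedBall x₀ ‖x - x₀‖ ⊆ Metric.ball x₀ r := by
    rw [Metric.mem_ball, dist_eq_norm] at hx
    exact Metric.closedBall_subset_ball hx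
  -- Mean value inequality on the ball of radius `‖x - x₀‖`, where `A` differs from `A x₀` by at
  -- most `|M| * ‖x - x₀‖`.
  have := (convex_closedBall x₀ ‖x - x₀‖).norm_image_sub_le_of_norm_hasFDerivWithin_le'
    (f := Φ) (f' := A) (φ := A x₀) (C := |M| * ‖x - x₀‖) (x := x₀) (y := x)
    (fun y hy => (hball y (hsub hy)).1.hasFDerivWithinAt)
    (fun y hy => by
      refine (hball y (hsub hy)).2.trans ?_
      have : ‖y - x₀‖ ≤ ‖x - x₀‖ := by simpa [dist_eq_norm] using hy
      calc _ ≤ |M| * ‖y - x₀‖ := by gcongr; exact le_abs_self M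
        _ ≤ _ := by gcongr)
    (by simp) (by simp [dist_eq_norm])
  rw [norm_pow, norm_norm]
  calc _ ≤ _ := this
    _ = _ := by ring

end Normed

/-! ### Second-order expansion and stationarity of penalized problems. -/

section Calculus

variable {X Y : Type*} [NormedAddCommGroup X] [InnerProductSpace ℝ X] [CompleteSpace X]
  [NormedAddCommGroup Y] [InnerProductSpace ℝ Y] [CompleteSpace Y]

theorem HasGradientAt.hasDerivAt_line {ψ : X → ℝ} {g x h : X} {t : ℝ}
    (hg : HasGradientAt ψ g (x + t • h)) :
    HasDerivAt (fun t : ℝ => ψ (x + t • h)) ⟪g, h⟫ t := by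
  have h1 : HasDerivAt (fun t : ℝ => x + t • h) h t := by
    simpa using ((hasDerivAt_id t).smul_const h).const_add x
  exact (hg.hasFDerivAt.comp_hasDerivAt t h1).congr_deriv (by simp)

/-- Second-order expansion at a stationary point. -/
theorem isLittleO_secondOrder {ψ : X → ℝ} {g : X → X} {H : X →L[ℝ] X} {x₀ : X}
    (hg : ∀ᶠ x in 𝓝 x₀, HasGradientAt ψ (g x) x) (hH : HasFDerivAt g H x₀) (h0 : g x₀ = 0) :
    (fun x => ψ x - ψ x₀ - 1 / 2 * ⟪H (x - x₀), x - x₀⟫) =o[𝓝 x₀] fun x => ‖x - x₀‖ ^ 2 := by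
  rw [Asymptotics.isLittleO_iff]
  intro ε hε
  have h1 := hH.isLittleO.def hε
  obtain ⟨r, hr, hball⟩ := Metric.eventually_nhds_iff_ball.1 (hg.and h1)
  filter_upwards [Metric.ball_mem_nhds x₀ hr] with x hx
  set h := x - x₀ with hh
  have hmem : ∀ t ∈ Set.Icc (0 : ℝ) 1, x₀ + t • h ∈ Metric.ball x₀ r := by
    intro t ht
    rw [Metric.mem_ball, dist_eq_norm] at hx ⊢
    rw [add_sub_cancel_left, norm_smul, Real.norm_of_nonneg ht.1]
    exact (mul_le_of_le_one_left (norm_nonneg _) ht.2).trans_lt hx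
  -- After removal of the quadratic part, the derivative along the segment is the first-order
  -- remainder of `g` paired with `h`, of size `ε * ‖h‖ ^ 2`.
  have hder : ∀ t ∈ Set.Icc (0 : ℝ) 1,
      HasDerivWithinAt (fun t : ℝ => ψ (x₀ + t • h) - t ^ 2 * (1 / 2 * ⟪H h, h⟫))
        (⟪g (x₀ + t • h), h⟫ - t * ⟪H h, h⟫) (Set.Icc 0 1) t := by
    intro t ht
    have := (HasGradientAt.hasDerivAt_line (hball _ (hmem t ht)).1).sub
      (((hasDerivAt_id t).pow 2).mul_const (1 / 2 * ⟪H h, h⟫))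
    refine this.hasDerivWithinAt.congr_deriv ?_
    simp; ring
  have hbound : ∀ t ∈ Set.Ico (0 : ℝ) 1, ‖⟪g (x₀ + t • h), h⟫ - t * ⟪H h, h⟫‖ ≤ ε * ‖h‖ ^ 2 := by
    intro t ht
    have h2 := (hball _ (hmem t ⟨ht.1, ht.2.le⟩)).2
    rw [h0, sub_zero, add_sub_cancel_left] at h2
    have h3 : ⟪g (x₀ + t • h), h⟫ - t * ⟪H h, h⟫ = ⟪g (x₀ + t • h) - H (t • h), h⟫ := by
      rw [inner_sub_left, map_smul, real_inner_smul_left]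
    rw [h3]
    refine (norm_inner_le_norm _ _).trans ?_
    calc _ ≤ ε * ‖t • h‖ * ‖h‖ := by gcongr
      _ ≤ ε * ‖h‖ * ‖h‖ := by
        gcongr
        rw [norm_smul, Real.norm_of_nonneg ht.1]
        exact mul_le_of_le_one_left (norm_nonneg _) ht.2.le
      _ = _ := by ring
  have := norm_image_sub_le_of_norm_deriv_le_segment' hder hbound 1 (by simp)
  simp only [one_smul, zero_smul, add_zero, one_pow, one_mul, sub_zero, mul_one] at this
  have hx' : x₀ + h = x := by simp [hh]
  rw [hx'] at this
  rw [norm_pow, norm_norm]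
  rw [zero_pow two_ne_zero, zero_mul, sub_zero] at this
  rw [sub_right_comm]
  exact this

/-- Positivity under the root keeps away from the kink of the norm; it is ensured either by
smoothing (`σ ≠ 0`) or by a nonzero violation `u`. -/
theorem hasGradientAt_penalty (ε C σ : ℝ) {u : Y} (hu : 0 < ‖u‖ ^ 2 + σ ^ 2) :
    HasGradientAt (penalty ε C σ) ((ε / √(‖u‖ ^ 2 + σ ^ 2) + 2 * C) • u) u := by
  have h1 : HasFDerivAt (fun u : Y => ‖u‖ ^ 2) (2 • innerSL ℝ u) u :=
    (hasStrictFDerivAt_norm_sq u).hasFDerivAt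
  have h2 := ((h1.add_const (σ ^ 2)).sqrt hu.ne').const_mul ε
  have h3 := h2.add (h1.const_mul C)
  rw [hasGradientAt_iff_hasFDerivAt]
  refine h3.congr_fderiv ?_
  ext w
  have := (Real.sqrt_pos.2 hu).ne'
  simp
  field_simp

/-- First-order conditions for a local minimizer of a penalized composite problem. -/
theorem stationary_of_isLocalMin {ψ : X → ℝ} {g x : X} {Φ : X → Y} {A : X →L[ℝ] Y} {N : Y → ℝ}
    {v d z : Y} {s : ℝ} {E : Set (Y × ℝ)} (hconv : Convex ℝ E)
    (hψ : HasGradientAt ψ g x) (hΦ : HasFDerivAt Φ A x)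
    (hN : HasGradientAt N (-v) (z + d - Φ x)) (hE : (d, s) ∈ E)
    (hmin : ∀ᶠ q : X × Y × ℝ in 𝓝 (x, d, s), q.2 ∈ E →
      ψ x + s + N (z + d - Φ x) ≤ ψ q.1 + q.2.2 + N (z + q.2.1 - Φ q.1)) :
    g + A.adjoint v = 0 ∧ ∀ q ∈ E, s + ⟪v, q.1 - d⟫ ≤ q.2 := by
  constructor
  · have ht : Tendsto (fun x' => (x', d, s)) (𝓝 x) (𝓝 (x, d, s)) :=
      (Continuous.prodMk_left (d, s)).tendsto x
    have hlm : IsLocalMin (fun x' => ψ x' + N (z + d - Φ x')) x := by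
      filter_upwards [ht.eventually hmin] with x' hx'
      have := hx' hE
      change ψ x + N (z + d - Φ x) ≤ ψ x' + N (z + d - Φ x')
      linarith
    have hd : HasFDerivAt (fun x' => ψ x' + N (z + d - Φ x')) _ x :=
      hψ.hasFDerivAt.add (hN.hasFDerivAt.comp x (hΦ.const_sub (z + d)))
    have h0 := hlm.hasFDerivAt_eq_zero hd
    refine ext_inner_right ℝ fun h => ?_
    have := DFunLike.congr_fun h0 h
    simp only [add_apply, ContinuousLinearMap.comp_apply,
      neg_apply, InnerProductSpace.toDual_apply_apply, inner_neg_left,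
      inner_neg_right, neg_neg, zero_apply] at this
    rw [inner_add_left, ContinuousLinearMap.adjoint_inner_left, inner_zero_left]
    exact this
  -- By convexity the segment from `(d, s)` to `q` stays in `E`, so the one-sided derivative along
  -- it is nonnegative.
  · intro q hq
    have ht : Tendsto (fun τ : ℝ => (x, (d, s) + τ • (q - (d, s)))) (𝓝[>] 0) (𝓝 (x, d, s)) := by
      have : Continuous (fun τ : ℝ => (x, (d, s) + τ • (q - (d, s)))) := by fun_prop
      have := (this.tendsto 0).mono_left (nhdsWithin_le_nhds (s := Set.Ioi 0))
      simpa using this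
    have hN' : HasGradientAt N (-v) ((z + d - Φ x) + (0 : ℝ) • (q.1 - d)) := by simpa using hN
    have hder : HasDerivAt (fun τ : ℝ => τ * (q.2 - s) + N ((z + d - Φ x) + τ • (q.1 - d)))
        ((q.2 - s) + ⟪-v, q.1 - d⟫) 0 := by
      exact (((hasDerivAt_id (0 : ℝ)).mul_const (q.2 - s)).add
        (HasGradientAt.hasDerivAt_line hN')).congr_deriv (by simp)
    have hlim := hder.tendsto_slope_zero_right
    have hnn : 0 ≤ (q.2 - s) + ⟪-v, q.1 - d⟫ := by
      refine ge_of_tendsto hlim ?_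
      filter_upwards [ht.eventually hmin, Ioo_mem_nhdsGT (zero_lt_one' ℝ)] with τ hτ hτ01
      have hmem : (d, s) + τ • (q - (d, s)) ∈ E :=
        hconv.add_smul_sub_mem hE hq ⟨hτ01.1.le, hτ01.2.le⟩
      have h1 := hτ hmem
      simp only [Prod.fst_add, Prod.snd_add, Prod.smul_fst, Prod.smul_snd, Prod.fst_sub,
        Prod.snd_sub, smul_eq_mul] at h1
      have h2 : z + (d + τ • (q.1 - d)) - Φ x = (z + d - Φ x) + τ • (q.1 - d) := by abel
      rw [h2] at h1
      refine smul_nonneg (inv_nonneg.2 hτ01.1.le) ?_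
      simp only [zero_add, zero_mul, zero_smul, add_zero]
      linarith
    rw [inner_neg_left] at hnn
    linarith

end Calculus

/-! ### The localized model -/

section Model

variable {X Y ι : Type*} [NormedAddCommGroup X] [InnerProductSpace ℝ X]
  [NormedAddCommGroup Y] [InnerProductSpace ℝ Y]

/-- Second-order smoothness data of a function `ψ` stationary at `x₀` and of a mapping `Φ`. -/
structure SmoothData [CompleteSpace X] (ψ : X → ℝ) (g : X → X) (H : X →L[ℝ] X) (Φ : X → Y) (A : X → X →L[ℝ] Y)
    (x₀ : X) : Prop where
  hasGradientAt : ∀ᶠ x in 𝓝 x₀, HasGradientAt ψ (g x) x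
  hasFDerivAt : ∀ᶠ x in 𝓝 x₀, HasFDerivAt Φ (A x) x
  continuousAt : ∀ᶠ x in 𝓝 x₀, ContinuousAt g x ∧ ContinuousAt A x
  differentiableAt : DifferentiableAt ℝ A x₀
  hess : HasFDerivAt g H x₀
  stationary : g x₀ = 0
  symm : ∀ u w, ⟪H u, w⟫ = ⟪H w, u⟫

/-- A polyhedral epigraph, recentered at a point where the function attains its minimum `0`. -/
structure LocalEpi (E : Set (Y × ℝ)) (a : ι → Y) (c β : ι → ℝ) : Prop where
  mem_iff : ∀ d s, (d, s) ∈ E ↔ ∀ i, ⟪a i, d⟫ + c i * s ≤ β i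
  slack_nonneg : ∀ i, 0 ≤ β i
  nonneg : ∀ q ∈ E, 0 ≤ q.2

/-- `v` is a subgradient at `d` of the convex function whose epigraph is `E`. -/
def IsSubgrad (E : Set (Y × ℝ)) (d v : Y) : Prop :=
  ∃ s, (d, s) ∈ E ∧ ∀ q ∈ E, s + ⟪v, q.1 - d⟫ ≤ q.2

/-- The cone cut out by the active constraints. -/
def activeCone (a : ι → Y) (β : ι → ℝ) : Set Y := {w | ∀ i, β i = 0 → ⟪a i, w⟫ ≤ 0}

namespace LocalEpi

variable {E : Set (Y × ℝ)} {a : ι → Y} {c β : ι → ℝ}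

theorem zero_mem (hE : LocalEpi E a c β) : ((0 : Y), (0 : ℝ)) ∈ E := by
  rw [hE.mem_iff]
  intro i
  simpa using hE.slack_nonneg i

theorem setOf_eq (hE : LocalEpi E a c β) : E = ⋂ i, {q | ⟪a i, q.1⟫ + c i * q.2 ≤ β i} := by
  ext ⟨d, s⟩
  simp [hE.mem_iff]

theorem isClosed (hE : LocalEpi E a c β) : IsClosed E := by
  rw [hE.setOf_eq]
  exact isClosed_iInter fun i => isClosed_le (by fun_prop) continuous_const

theorem convex (hE : LocalEpi E a c β) : Convex ℝ E := by
  rw [hE.setOf_eq]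
  refine convex_iInter fun i => ?_
  have : IsLinearMap ℝ fun q : Y × ℝ => ⟪a i, q.1⟫ + c i * q.2 :=
    ⟨fun p q => by simp [inner_add_right]; ring, fun r q => by
      simp [real_inner_smul_right]; ring⟩
  exact convex_halfSpace_le this _

/-- Active constraints are homogeneous and inactive ones have slack, so a whole initial segment of
the ray lies in `E` at height 0. -/
theorem eventually_smul_mem [Finite ι] (hE : LocalEpi E a c β) {w : Y} (hw : w ∈ activeCone a β) :
    ∀ᶠ t : ℝ in 𝓝[>] 0, (t • w, (0 : ℝ)) ∈ E := by
  simp only [hE.mem_iff]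
  rw [Filter.eventually_all]
  intro i
  rcases (hE.slack_nonneg i).eq_or_lt with h | h
  · filter_upwards [self_mem_nhdsWithin] with t ht
    rw [real_inner_smul_right, ← h]
    simpa using mul_nonpos_of_nonneg_of_nonpos (le_of_lt ht) (hw i h.symm)
  · have : Tendsto (fun t : ℝ => ⟪a i, t • w⟫ + c i * 0) (𝓝[>] 0) (𝓝 0) := by
      have : Continuous (fun t : ℝ => ⟪a i, t • w⟫ + c i * 0) := by fun_prop
      simpa using (this.tendsto 0).mono_left (nhdsWithin_le_nhds (s := Set.Ioi 0))
    filter_upwards [this.eventually (gt_mem_nhds h)] with t ht using ht.le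

/-- Active constraints survive division by `t`; heights of order `o(t)` disappear in the limit. -/
theorem mem_activeCone_of_tendsto (hE : LocalEpi E a c β) {α : Type*} {l : Filter α} [l.NeBot]
    {d : α → Y} {s t : α → ℝ} {w : Y} (hmem : ∀ᶠ k in l, (d k, s k) ∈ E)
    (ht : ∀ᶠ k in l, 0 < t k) (hd : Tendsto (fun k => (t k)⁻¹ • d k) l (𝓝 w))
    (hs : Tendsto (fun k => (t k)⁻¹ * s k) l (𝓝 0)) : w ∈ activeCone a β := by
  intro i hi
  have hlim : Tendsto (fun k => ⟪a i, (t k)⁻¹ • d k⟫ + c i * ((t k)⁻¹ * s k)) l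
      (𝓝 (⟪a i, w⟫ + c i * 0)) := (tendsto_const_nhds.inner hd).add (hs.const_mul (c i))
  rw [mul_zero, add_zero] at hlim
  refine le_of_tendsto hlim ?_
  filter_upwards [hmem, ht] with k hk htk
  have := (hE.mem_iff _ _).1 hk i
  rw [hi] at this
  rw [real_inner_smul_right]
  calc _ = (t k)⁻¹ * (⟪a i, d k⟫ + c i * s k) := by ring
    _ ≤ 0 := mul_nonpos_of_nonneg_of_nonpos (inv_nonneg.2 htk.le) this

/-- Nonnegative combinations of active constraint normals become subgradients after scaling. -/
theorem inner_sum_le [Fintype ι] (hE : LocalEpi E a c β) {J : Finset ι} (hJ : ∀ i ∈ J, β i = 0)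
    {ν : ι → ℝ} (hν : ∀ i, 0 ≤ ν i) :
    ∃ τ : ℝ, 0 < τ ∧ ∀ t, 0 ≤ t → t ≤ τ → ∀ q ∈ E, ⟪t • ∑ i ∈ J, ν i • a i, q.1⟫ ≤ q.2 := by
  set σ := |∑ i ∈ J, ν i * c i| with hσ
  -- On `E` the combination is at most `σ * q.2`, so any factor with `t * σ ≤ 1` will do; the added
  -- 1 covers `σ = 0`.
  refine ⟨(σ + 1)⁻¹, by positivity, fun t ht htτ q hq => ?_⟩
  have h1 : ∀ i ∈ J, ν i * ⟪a i, q.1⟫ ≤ - (ν i * c i) * q.2 := fun i hi => by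
    have := (hE.mem_iff q.1 q.2).1 hq i
    rw [hJ i hi] at this
    nlinarith [hν i]
  have h2 : ⟪∑ i ∈ J, ν i • a i, q.1⟫ ≤ σ * q.2 := by
    rw [sum_inner]
    simp only [real_inner_smul_left]
    refine (Finset.sum_le_sum h1).trans ?_
    rw [← Finset.sum_mul, Finset.sum_neg_distrib]
    exact mul_le_mul_of_nonneg_right (neg_le_abs _) (hE.nonneg q hq)
  have hσ0 : 0 ≤ σ := abs_nonneg _
  have h3 : t * σ ≤ 1 := by
    have : t * (σ + 1) ≤ 1 := by
      rw [← le_div_iff₀ (by positivity), one_div]; exact htτ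
    nlinarith
  rw [real_inner_smul_left]
  nlinarith [hE.nonneg q hq, mul_le_mul_of_nonneg_left h2 ht,
    mul_le_mul_of_nonneg_right h3 (hE.nonneg q hq)]

/-- Elements of the polar of the active cone become subgradients after scaling. -/
theorem exists_smul_inner_le_of_polar [Fintype ι] (hE : LocalEpi E a c β) {η : Y}
    (hη : ∀ w ∈ activeCone a β, ⟪η, w⟫ ≤ 0) : ∃ t : ℝ, 0 < t ∧ ∀ q ∈ E, ⟪t • η, q.1⟫ ≤ q.2 := by
  classical
  obtain ⟨ν, hν, hsum⟩ := exists_nonneg_sum_of_farkas (Finset.univ.filter fun i => β i = 0)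
    (fun i => innerₗ Y (a i)) (innerₗ Y η) (fun w hw => hη w fun i hi => hw i (by simpa using hi))
  have : η = ∑ i ∈ Finset.univ.filter (fun i => β i = 0), ν i • a i := by
    refine ext_inner_right ℝ fun w => ?_
    have := LinearMap.congr_fun hsum w
    simpa [sum_inner, real_inner_smul_left] using this
  obtain ⟨τ, hτ, h⟩ := hE.inner_sum_le (J := Finset.univ.filter fun i => β i = 0)
    (fun i hi => by simpa using hi) hν
  exact ⟨τ, hτ, by rw [this]; exact h τ hτ.le le_rfl⟩

end LocalEpi

/-- No nonzero subgradient at the origin is annihilated by the adjoint of `A`. -/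
def UniqueMultiplier [CompleteSpace X] [CompleteSpace Y] (E : Set (Y × ℝ))
    (A : X →L[ℝ] Y) : Prop :=
  ∀ η, (∀ q ∈ E, ⟪η, q.1⟫ ≤ q.2) → A.adjoint η = 0 → η = 0

section

variable {ψ : X → ℝ} {g : X → X} {H : X →L[ℝ] X} {Φ : X → Y} {A : X → X →L[ℝ] Y} {x₀ : X}
  {E : Set (Y × ℝ)} {a : ι → Y} {c β : ι → ℝ}

theorem tendsto_clm_apply {α : Type*} {l : Filter α}
    {B : α → X →L[ℝ] Y} {B₀ : X →L[ℝ] Y} {v : α → X} {v₀ : X} (hB : Tendsto B l (𝓝 B₀))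
    (hv : Tendsto v l (𝓝 v₀)) : Tendsto (fun k => B k (v k)) l (𝓝 (B₀ v₀)) := by
  have h2 : Continuous fun p : (X →L[ℝ] Y) × X => p.1 p.2 := isBoundedBilinearMap_apply.continuous
  have h3 := h2.tendsto (B₀, v₀)
  exact h3.comp (hB.prodMk_nhds hv)

theorem tendsto_adjoint_apply [CompleteSpace X] [CompleteSpace Y] {α : Type*} {l : Filter α}
    {B : α → X →L[ℝ] Y} {B₀ : X →L[ℝ] Y} {v : α → Y} {v₀ : Y} (hB : Tendsto B l (𝓝 B₀))
    (hv : Tendsto v l (𝓝 v₀)) :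
    Tendsto (fun k => (B k).adjoint (v k)) l (𝓝 (B₀.adjoint v₀)) :=
  tendsto_clm_apply ((ContinuousLinearMap.adjoint
    (𝕜 := ℝ) (E := X) (F := Y)).continuous.continuousAt.tendsto.comp hB) hv

/-- Approximate multipliers tend to zero if zero is the unique multiplier. -/
theorem tendsto_multiplier [CompleteSpace X] [CompleteSpace Y] [FiniteDimensional ℝ Y]
    (hE : LocalEpi E a c β) (hA : ContinuousAt A x₀) (hU : UniqueMultiplier E (A x₀))
    {α : Type*} {l : Filter α} {x : α → X} {d v : α → Y} (hx : Tendsto x l (𝓝 x₀))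
    (hd : Tendsto d l (𝓝 0)) (hsub : ∀ᶠ k in l, IsSubgrad E (d k) (v k))
    (hg : Tendsto (fun k => (A (x k)).adjoint (v k)) l (𝓝 0)) : Tendsto v l (𝓝 0) := by
  rw [tendsto_iff_ultrafilter]
  intro 𝒰 h𝒰
  -- Dividing by `1 + ‖v k‖` treats bounded and unbounded multipliers at once. Since heights in `E`
  -- are nonnegative, a cluster point is again a subgradient at the origin, and the adjoint of `A
  -- x₀` annihilates it.
  set w : α → Y := fun k => (1 + ‖v k‖)⁻¹ • v k with hw
  have hpos : ∀ k, 0 < 1 + ‖v k‖ := fun k => by positivity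
  have hinv : ∀ k, (1 + ‖v k‖)⁻¹ ≤ 1 := fun k => inv_le_one_of_one_le₀ (by simp)
  have hwn : ∀ k, ‖w k‖ = ‖v k‖ / (1 + ‖v k‖) := fun k => by
    rw [hw, norm_smul, Real.norm_of_nonneg (inv_nonneg.2 (hpos k).le)]; ring
  obtain ⟨w₀, -, hw₀⟩ := exists_tendsto_of_eventually_mem 𝒰 (isCompact_closedBall (0 : Y) 1)
    (f := w) (Eventually.of_forall fun k => by
      rw [mem_closedBall_zero_iff, hwn, div_le_one (hpos k)]; linarith)
  have hw₀0 : w₀ = 0 := by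
    refine hU w₀ (fun q hq => ?_) ?_
    · have hlim : Tendsto (fun k => ⟪w k, q.1 - d k⟫) 𝒰 (𝓝 ⟪w₀, q.1 - 0⟫) :=
        hw₀.inner (tendsto_const_nhds.sub (hd.mono_left h𝒰))
      rw [sub_zero] at hlim
      refine le_of_tendsto hlim ?_
      filter_upwards [hsub.filter_mono h𝒰] with k hk
      obtain ⟨s, hs, hk⟩ := hk
      have h1 := hk q hq
      have h2 := hE.nonneg _ hs
      have h3 := hE.nonneg _ hq
      simp only at h2
      rw [real_inner_smul_left]
      calc _ ≤ (1 + ‖v k‖)⁻¹ * q.2 :=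
            mul_le_mul_of_nonneg_left (by linarith) (inv_nonneg.2 (hpos k).le)
        _ ≤ q.2 := mul_le_of_le_one_left h3 (hinv k)
    · have hlim : Tendsto (fun k => (A (x k)).adjoint (w k)) 𝒰 (𝓝 ((A x₀).adjoint w₀)) :=
        tendsto_adjoint_apply (hA.tendsto.comp (hx.mono_left h𝒰)) hw₀
      refine tendsto_nhds_unique hlim ?_
      refine squeeze_zero_norm (fun k => ?_) (tendsto_zero_iff_norm_tendsto_zero.1
        (hg.mono_left h𝒰))
      rw [hw, map_smul, norm_smul, Real.norm_of_nonneg (inv_nonneg.2 (hpos k).le)]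
      exact mul_le_of_le_one_left (norm_nonneg _) (hinv k)
  rw [hw₀0] at hw₀
  have hn : Tendsto (fun k => ‖w k‖) 𝒰 (𝓝 0) := tendsto_zero_iff_norm_tendsto_zero.1 hw₀
  rw [tendsto_zero_iff_norm_tendsto_zero]
  -- The normalization is invertible: `‖v k‖ = ‖w k‖ / (1 - ‖w k‖)`.
  have h4 : Tendsto (fun k => ‖w k‖ / (1 - ‖w k‖)) 𝒰 (𝓝 (0 / (1 - 0))) :=
    hn.div (tendsto_const_nhds.sub hn) (by norm_num)
  rw [zero_div] at h4
  refine h4.congr fun k => ?_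
  rw [hwn]
  have := (hpos k).ne'
  field_simp
  ring

end

end Model

/-! ### Blow-up limits -/

section BlowUp

variable {X Z : Type*} [NormedAddCommGroup X] [NormedSpace ℝ X] [NormedAddCommGroup Z]
  [NormedSpace ℝ Z]

/-- The scale `t` need not be `‖x k - x₀‖`: boundedness of the rescaled increments absorbs the
remainder. -/
theorem HasFDerivAt.tendsto_blowup {f : X → Z} {L : X →L[ℝ] Z} {x₀ : X} (hf : HasFDerivAt f L x₀)
    {α : Type*} {l : Filter α} {x : α → X} {t : α → ℝ} {h : X} (hx : Tendsto x l (𝓝 x₀))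
    (hh : Tendsto (fun k => (t k)⁻¹ • (x k - x₀)) l (𝓝 h)) :
    Tendsto (fun k => (t k)⁻¹ • (f (x k) - f x₀)) l (𝓝 (L h)) := by
  have h1 := (hf.isLittleO.comp_tendsto hx)
  have h2 := (Asymptotics.isBigO_refl (fun k => (t k)⁻¹) l).smul_isLittleO h1
  have h4 := (L.continuous.tendsto h).comp hh
  have h5 := h4.add (((Asymptotics.isLittleO_one_iff ℝ).1 (h2.trans_isBigO (hh.isBigO_one ℝ))))
  rw [add_zero] at h5
  refine h5.congr fun k => ?_
  simp only [Function.comp_apply, map_smul]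
  rw [← smul_add]
  congr 1
  abel

theorem tendsto_line {x₀ : X} (u : X) : Tendsto (fun t : ℝ => x₀ + t • u) (𝓝[>] 0) (𝓝 x₀) := by
  have : Continuous (fun t : ℝ => x₀ + t • u) := by fun_prop
  simpa using (this.tendsto 0).mono_left (nhdsWithin_le_nhds (s := Set.Ioi 0))

theorem tendsto_line_blowup {x₀ : X} (u : X) :
    Tendsto (fun t : ℝ => t⁻¹ • (x₀ + t • u - x₀)) (𝓝[>] 0) (𝓝 u) := by
  refine tendsto_const_nhds.congr' ?_
  filter_upwards [self_mem_nhdsWithin] with t ht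
  rw [add_sub_cancel_left, inv_smul_smul₀ (ne_of_gt ht)]

end BlowUp

/-! ### Compact feasible sets and rescaling of the smooth data. -/

section Feasible

variable {X Y : Type*} [NormedAddCommGroup X] [NormedAddCommGroup Y]

/-- The points near `(x₀, 0, 0)` whose last two components lie in the recentered epigraph. -/
def feasible (x₀ : X) (r : ℝ) (E : Set (Y × ℝ)) : Set (X × Y × ℝ) :=
  Metric.closedBall (x₀, 0, 0) r ∩ {q | q.2 ∈ E}

theorem fst_mem_of_mem_feasible {x₀ : X} {E : Set (Y × ℝ)} {r : ℝ} {q : X × Y × ℝ} (hq : q ∈ feasible x₀ r E) :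
    q.1 ∈ Metric.closedBall x₀ r := by
  have h := hq.1
  rw [Metric.mem_closedBall, Prod.dist_eq] at h
  exact (le_max_left _ _).trans h

end Feasible

section Model

variable {X Y ι : Type*} [NormedAddCommGroup X] [InnerProductSpace ℝ X]
  [NormedAddCommGroup Y] [InnerProductSpace ℝ Y] 
  {ψ : X → ℝ} {g : X → X} {H : X →L[ℝ] X} {Φ : X → Y} {A : X → X →L[ℝ] Y} {x₀ : X}
  {E : Set (Y × ℝ)} {a : ι → Y} {c β : ι → ℝ}

namespace SmoothData

variable [CompleteSpace X]

theorem hasFDerivAt_self (hS : SmoothData ψ g H Φ A x₀) : HasFDerivAt Φ (A x₀) x₀ :=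
  hS.hasFDerivAt.self_of_nhds

/-- Stationarity removes the linear term, so `ψ` is rescaled by the square of `t`. -/
theorem tendsto_blowup_sq (hS : SmoothData ψ g H Φ A x₀)
    {α : Type*} {l : Filter α} {x : α → X} {t : α → ℝ} {h : X} (hx : Tendsto x l (𝓝 x₀))
    (hh : Tendsto (fun k => (t k)⁻¹ • (x k - x₀)) l (𝓝 h)) :
    Tendsto (fun k => ((t k)⁻¹ ^ 2) * (ψ (x k) - ψ x₀)) l (𝓝 (1 / 2 * ⟪H h, h⟫)) := by
  have h1 := (isLittleO_secondOrder hS.hasGradientAt hS.hess hS.stationary).comp_tendsto hx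
  have h2 := (Asymptotics.isBigO_refl (fun k => (t k)⁻¹ ^ 2) l).mul_isLittleO h1
  have h3 : Tendsto (fun k => (t k)⁻¹ ^ 2 * ‖x k - x₀‖ ^ 2) l (𝓝 (‖h‖ ^ 2)) := by
    refine (hh.norm.pow 2).congr fun k => ?_
    rw [norm_smul, mul_pow, Real.norm_eq_abs, sq_abs]
  have h5 := (Asymptotics.isLittleO_one_iff ℝ).1 (h2.trans_isBigO (h3.isBigO_one ℝ))
  have h6 := ((((H.continuous.tendsto h).comp hh).inner hh).const_mul (1 / 2)).add h5
  rw [add_zero] at h6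
  refine h6.congr fun k => ?_
  simp only [Function.comp_apply, map_smul, real_inner_smul_left, real_inner_smul_right]
  ring

theorem exists_radius (hS : SmoothData ψ g H Φ A x₀) {P : X → Prop}
    (hP : ∀ᶠ x in 𝓝 x₀, P x) : ∃ r > 0, ∀ x ∈ Metric.closedBall x₀ r,
      HasGradientAt ψ (g x) x ∧ HasFDerivAt Φ (A x) x ∧ ContinuousAt g x ∧ ContinuousAt A x ∧
        P x := by
  obtain ⟨r, hr, h⟩ := Metric.nhds_basis_closedBall.eventually_iff.1
    (hS.hasGradientAt.and (hS.hasFDerivAt.and (hS.continuousAt.and hP)))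
  exact ⟨r, hr, fun x hx => ⟨(h hx).1, (h hx).2.1, (h hx).2.2.1.1, (h hx).2.2.1.2, (h hx).2.2.2⟩⟩

end SmoothData

/-! ### Penalized problems -/

theorem exists_feasible_minimizer [FiniteDimensional ℝ X] [FiniteDimensional ℝ Y]
    (hE : LocalEpi E a c β) {r : ℝ} (hr : 0 ≤ r)
    (hψ : ContinuousOn ψ (Metric.closedBall x₀ r)) (hΦ : ContinuousOn Φ (Metric.closedBall x₀ r))
    {N : Y → ℝ} (hN : Continuous N) (z : Y) :
    ∃ q ∈ feasible x₀ r E, ∀ p ∈ feasible x₀ r E,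
      ψ q.1 + q.2.2 + N (z + q.2.1 - Φ q.1) ≤ ψ p.1 + p.2.2 + N (z + p.2.1 - Φ p.1) := by
  have hK : IsCompact (feasible x₀ r E) :=
    (isCompact_closedBall _ _).inter_right (hE.isClosed.preimage continuous_snd)
  have hmaps : Set.MapsTo Prod.fst (feasible x₀ r E) (Metric.closedBall x₀ r) :=
    fun q hq => fst_mem_of_mem_feasible hq
  have h1 : ContinuousOn (fun q : X × Y × ℝ => ψ q.1) (feasible x₀ r E) :=
    hψ.comp continuous_fst.continuousOn hmaps
  have h2 : ContinuousOn (fun q : X × Y × ℝ => Φ q.1) (feasible x₀ r E) :=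
    hΦ.comp continuous_fst.continuousOn hmaps
  have h3 : ContinuousOn (fun q : X × Y × ℝ => ψ q.1 + q.2.2 + N (z + q.2.1 - Φ q.1))
      (feasible x₀ r E) := by
    refine (h1.add (by fun_prop)).add (hN.comp_continuousOn ?_)
    exact ContinuousOn.sub (by fun_prop) h2
  obtain ⟨q, hq, hmin⟩ := hK.exists_isMinOn
    ⟨(x₀, 0, 0), Metric.mem_closedBall_self hr, hE.zero_mem⟩ h3
  exact ⟨q, hq, fun p hp => hmin hp⟩

/-- Minimizers of the perturbed penalized problems tend to the reference point as the perturbation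
and the smoothing parameter vanish. -/
theorem tendsto_penalized_minimizer [FiniteDimensional ℝ X] [FiniteDimensional ℝ Y]
    (hE : LocalEpi E a c β) {r : ℝ} (hr : 0 < r)
    (hψ : ∀ x ∈ Metric.closedBall x₀ r, ContinuousAt ψ x)
    (hΦ : ∀ x ∈ Metric.closedBall x₀ r, ContinuousAt Φ x)
    (hgrow : ∀ q ∈ feasible x₀ r E,
      ψ q.1 + q.2.2 + ‖Φ x₀ + q.2.1 - Φ q.1‖ ≤ ψ x₀ → q.1 = x₀)
    {q : (X × Y) × ℝ → X × Y × ℝ} (hq : ∀ k, q k ∈ feasible x₀ r E)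
    (hqmin : ∀ k, ∀ w ∈ feasible x₀ r E,
      ψ (q k).1 - ⟪k.1.1, (q k).1⟫ + (q k).2.2 +
          penalty 1 0 k.2 (Φ x₀ - k.1.2 + (q k).2.1 - Φ (q k).1) ≤
        ψ w.1 - ⟪k.1.1, w.1⟫ + w.2.2 + penalty 1 0 k.2 (Φ x₀ - k.1.2 + w.2.1 - Φ w.1)) :
    Tendsto q (𝓝 0 ×ˢ 𝓝[>] 0) (𝓝 (x₀, 0, 0)) := by
  have hK : IsCompact (feasible x₀ r E) :=
    (isCompact_closedBall _ _).inter_right (hE.isClosed.preimage continuous_snd)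
  rw [tendsto_iff_ultrafilter]
  intro 𝒰 h𝒰
  have hlp : Tendsto (fun k : (X × Y) × ℝ => k.1) 𝒰 (𝓝 0) := tendsto_fst.mono_left h𝒰
  have hlp1 : Tendsto (fun k : (X × Y) × ℝ => k.1.1) 𝒰 (𝓝 0) :=
    (continuous_fst.tendsto (0 : X × Y)).comp hlp
  have hlp2 : Tendsto (fun k : (X × Y) × ℝ => k.1.2) 𝒰 (𝓝 0) :=
    (continuous_snd.tendsto (0 : X × Y)).comp hlp
  have hlσ : Tendsto (fun k : (X × Y) × ℝ => k.2) 𝒰 (𝓝 0) :=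
    (tendsto_snd.mono_right nhdsWithin_le_nhds).mono_left h𝒰
  have hpen0 : ∀ u : Y, penalty 1 0 0 u = ‖u‖ := fun u => by
    rw [penalty, zero_pow two_ne_zero, add_zero, Real.sqrt_sq (norm_nonneg _)]
    ring
  obtain ⟨q₀, hq₀, hlim⟩ := exists_tendsto_of_eventually_mem 𝒰 hK (f := q)
    (Eventually.of_forall hq)
  have hx₀ := fst_mem_of_mem_feasible hq₀
  have hl1 : Tendsto (fun k => (q k).1) 𝒰 (𝓝 q₀.1) := (continuous_fst.tendsto _).comp hlim
  have hl2 : Tendsto (fun k => (q k).2.1) 𝒰 (𝓝 q₀.2.1) :=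
    ((continuous_fst.comp continuous_snd).tendsto _).comp hlim
  have hl3 : Tendsto (fun k => (q k).2.2) 𝒰 (𝓝 q₀.2.2) :=
    ((continuous_snd.comp continuous_snd).tendsto _).comp hlim
  have hΦl : Tendsto (fun k => Φ (q k).1) 𝒰 (𝓝 (Φ q₀.1)) := (hΦ _ hx₀).tendsto.comp hl1
  have hψl : Tendsto (fun k => ψ (q k).1) 𝒰 (𝓝 (ψ q₀.1)) := (hψ _ hx₀).tendsto.comp hl1
  have hzl : Tendsto (fun k : (X × Y) × ℝ => Φ x₀ - k.1.2) 𝒰 (𝓝 (Φ x₀)) := by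
    simpa using hlp2.const_sub (Φ x₀)
  have hul : Tendsto (fun k => Φ x₀ - k.1.2 + (q k).2.1 - Φ (q k).1) 𝒰
      (𝓝 (Φ x₀ + q₀.2.1 - Φ q₀.1)) := (hzl.add hl2).sub hΦl
  have hip : Tendsto (fun k : (X × Y) × ℝ => ⟪k.1.1, (q k).1⟫) 𝒰 (𝓝 ⟪(0 : X), q₀.1⟫) :=
    hlp1.inner hl1
  have hip0 : Tendsto (fun k : (X × Y) × ℝ => ⟪k.1.1, x₀⟫) 𝒰 (𝓝 ⟪(0 : X), x₀⟫) :=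
    hlp1.inner tendsto_const_nhds
  have hL := ((hψl.sub hip).add hl3).add (tendsto_penalty hul hlσ 1 0)
  have hzl0 : Tendsto (fun k : (X × Y) × ℝ => Φ x₀ - k.1.2 + (0 : Y) - Φ x₀) 𝒰 (𝓝 0) := by
    simpa using (hzl.add_const (0 : Y)).sub_const (Φ x₀)
  have hR := ((hip0.const_sub (ψ x₀)).add_const 0).add (tendsto_penalty hzl0 hlσ 1 0)
  -- Comparison with the competitor `(x₀, 0, 0)` becomes, in the limit, the inequality required by
  -- `hgrow`.
  have hle := le_of_tendsto_of_tendsto hL hR (Eventually.of_forall fun k =>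
    hqmin k (x₀, 0, 0) ⟨Metric.mem_closedBall_self hr.le, hE.zero_mem⟩)
  simp only [inner_zero_left, sub_zero, hpen0, norm_zero, add_zero] at hle
  have hx0 : q₀.1 = x₀ := hgrow q₀ hq₀ hle
  have hs0 := hE.nonneg _ hq₀.2
  have hn0 := norm_nonneg (Φ x₀ + q₀.2.1 - Φ q₀.1)
  rw [hx0] at hle hn0
  have hn : ‖Φ x₀ + q₀.2.1 - Φ x₀‖ = 0 := by linarith
  rw [norm_eq_zero, add_sub_cancel_left] at hn
  have hs : q₀.2.2 = 0 := by linarith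
  have : q₀ = (x₀, 0, 0) := Prod.ext hx0 (Prod.ext hn hs)
  rwa [this] at hlim

variable [CompleteSpace X] [CompleteSpace Y]

/-- Lying in the open ball removes the artificial ball constraint. The multiplier is minus the
gradient of the penalty at the violation. -/
theorem stationary_of_feasible_minimizer (hE : LocalEpi E a c β) {r : ℝ} {q : X × Y × ℝ}
    (hq : q ∈ feasible x₀ r E) (hint : q ∈ Metric.ball (x₀, 0, 0) r) {g' : X} {B : X →L[ℝ] Y}
    (hψ : HasGradientAt ψ g' q.1) (hΦ : HasFDerivAt Φ B q.1) {ε C σ : ℝ} {z : Y}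
    (hpos : 0 < ‖z + q.2.1 - Φ q.1‖ ^ 2 + σ ^ 2)
    (hmin : ∀ p ∈ feasible x₀ r E, ψ q.1 + q.2.2 + penalty ε C σ (z + q.2.1 - Φ q.1) ≤
      ψ p.1 + p.2.2 + penalty ε C σ (z + p.2.1 - Φ p.1)) {v : Y}
    (hv : v = -((ε / √(‖z + q.2.1 - Φ q.1‖ ^ 2 + σ ^ 2) + 2 * C) • (z + q.2.1 - Φ q.1))) :
    g' + B.adjoint v = 0 ∧ ∀ p ∈ E, q.2.2 + ⟪v, p.1 - q.2.1⟫ ≤ p.2 := by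
  refine stationary_of_isLocalMin (N := penalty ε C σ) (z := z) hE.convex hψ hΦ ?_ hq.2 ?_
  · rw [hv, neg_neg]
    exact hasGradientAt_penalty ε C σ hpos
  · filter_upwards [Metric.isOpen_ball.mem_nhds hint] with p hp hpE
    exact hmin p ⟨Metric.ball_subset_closedBall hp, hpE⟩

/-- Exact penalization at a local minimizer with a unique multiplier. -/
theorem exists_penalty_bound [FiniteDimensional ℝ X] [FiniteDimensional ℝ Y]
    (hS : SmoothData ψ g H Φ A x₀) (hE : LocalEpi E a c β) (hU : UniqueMultiplier E (A x₀))
    (hmin : ∀ᶠ x in 𝓝 x₀, ∀ s, (Φ x - Φ x₀, s) ∈ E → ψ x₀ ≤ ψ x + s) {ε : ℝ} (hε : 0 < ε) :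
    ∃ C, ∀ᶠ q : X × Y × ℝ in 𝓝 (x₀, 0, 0), q.2 ∈ E →
      ψ x₀ ≤ ψ q.1 + ε * ‖q.1 - x₀‖ ^ 2 + q.2.2 + penalty ε C 0 (Φ x₀ + q.2.1 - Φ q.1) := by
  obtain ⟨r, hr, hball⟩ := hS.exists_radius hmin
  have hfst : ∀ q ∈ feasible x₀ r E, q.1 ∈ Metric.closedBall x₀ r :=
    fun q hq => fst_mem_of_mem_feasible hq
  have hΦc : ContinuousOn Φ (Metric.closedBall x₀ r) :=
    fun x hx => (hball x hx).2.1.continuousAt.continuousWithinAt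
  -- The quadratic term forces the limit of the penalized minimizers to be `x₀`.
  have hψd : ∀ x ∈ Metric.closedBall x₀ r,
      HasGradientAt (fun x => ψ x + ε * ‖x - x₀‖ ^ 2) (g x + (2 * ε) • (x - x₀)) x := by
    intro x hx
    have h1 : HasFDerivAt (fun x : X => ‖x - x₀‖ ^ 2) _ x :=
      ((hasFDerivAt_id x).sub_const x₀).norm_sq
    rw [hasGradientAt_iff_hasFDerivAt]
    refine ((hball x hx).1.hasFDerivAt.add (h1.const_mul ε)).congr_fderiv ?_
    ext w
    simp
    ring
  have hψc : ContinuousOn (fun x => ψ x + ε * ‖x - x₀‖ ^ 2) (Metric.closedBall x₀ r) :=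
    fun x hx => (hψd x hx).hasFDerivAt.continuousAt.continuousWithinAt
  choose q hq hqmin using fun C : ℝ => exists_feasible_minimizer hE hr.le hψc hΦc
    (continuous_penalty ε C 0) (Φ x₀)
  -- If no `C` works, every penalized minimizer has value below `ψ x₀`; these minimizers are
  -- followed along an ultrafilter with `C → ∞`.
  by_contra hcon
  push Not at hcon
  have hlt : ∀ C, ψ (q C).1 + ε * ‖(q C).1 - x₀‖ ^ 2 + (q C).2.2 +
      penalty ε C 0 (Φ x₀ + (q C).2.1 - Φ (q C).1) < ψ x₀ := by
    intro C
    obtain ⟨p, ⟨hpE, hplt⟩, hp⟩ :=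
      ((hcon C).and_eventually (Metric.closedBall_mem_nhds (x₀, (0 : Y), (0 : ℝ)) hr)).exists
    exact (hqmin C p ⟨hp, hpE⟩).trans_lt hplt
  have hK : IsCompact (feasible x₀ r E) :=
    (isCompact_closedBall _ _).inter_right (hE.isClosed.preimage continuous_snd)
  let 𝒰 : Ultrafilter ℝ := Ultrafilter.of atTop
  have h𝒰 : (𝒰 : Filter ℝ) ≤ atTop := Ultrafilter.of_le _
  obtain ⟨q₀, hq₀, hlim⟩ := exists_tendsto_of_eventually_mem 𝒰 hK (f := q)
    (Eventually.of_forall hq)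
  have hx₀ := hfst q₀ hq₀
  have hl1 : Tendsto (fun C => (q C).1) 𝒰 (𝓝 q₀.1) := (continuous_fst.tendsto _).comp hlim
  have hl2 : Tendsto (fun C => (q C).2.1) 𝒰 (𝓝 q₀.2.1) :=
    ((continuous_fst.comp continuous_snd).tendsto _).comp hlim
  have hl3 : Tendsto (fun C => (q C).2.2) 𝒰 (𝓝 q₀.2.2) :=
    ((continuous_snd.comp continuous_snd).tendsto _).comp hlim
  have hΦl : Tendsto (fun C => Φ (q C).1) 𝒰 (𝓝 (Φ q₀.1)) :=
    (hball _ hx₀).2.1.continuousAt.tendsto.comp hl1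
  have hψl : Tendsto (fun C => ψ (q C).1 + ε * ‖(q C).1 - x₀‖ ^ 2) 𝒰
      (𝓝 (ψ q₀.1 + ε * ‖q₀.1 - x₀‖ ^ 2)) :=
    (hψd _ hx₀).hasFDerivAt.continuousAt.tendsto.comp hl1
  have hul : Tendsto (fun C => Φ x₀ + (q C).2.1 - Φ (q C).1) 𝒰 (𝓝 (Φ x₀ + q₀.2.1 - Φ q₀.1)) :=
    (tendsto_const_nhds.add hl2).sub hΦl
  have hs0 : ∀ C, 0 ≤ (q C).2.2 := fun C => hE.nonneg _ (hq C).2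
  have hCpos : ∀ᶠ C : ℝ in (𝒰 : Filter ℝ), 0 < C := (eventually_gt_atTop 0).filter_mono h𝒰
  have hsq0 : ∀ C : ℝ, √(‖Φ x₀ + (q C).2.1 - Φ (q C).1‖ ^ 2 + 0 ^ 2)
      = ‖Φ x₀ + (q C).2.1 - Φ (q C).1‖ := fun C => by
    rw [zero_pow two_ne_zero, add_zero, Real.sqrt_sq (norm_nonneg _)]
  -- `C` times the squared violation stays bounded, so the violation vanishes in the limit.
  have hu0 : Φ x₀ + q₀.2.1 - Φ q₀.1 = 0 := by
    have hb : Tendsto (fun C => (ψ x₀ - (ψ (q C).1 + ε * ‖(q C).1 - x₀‖ ^ 2)) / C) 𝒰 (𝓝 0) :=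
      (tendsto_const_nhds.sub hψl).div_atTop (tendsto_id.mono_left h𝒰)
    have := le_of_tendsto_of_tendsto (hul.norm.pow 2) hb (by
      filter_upwards [hCpos] with C hC
      have h1 := hlt C
      rw [penalty, hsq0] at h1
      rw [le_div_iff₀ hC]
      have := hs0 C
      have : 0 ≤ ε * ‖Φ x₀ + (q C).2.1 - Φ (q C).1‖ := by positivity
      linarith)
    exact norm_eq_zero.1 (pow_eq_zero_iff two_ne_zero |>.1 (le_antisymm this (by positivity)))
  have hd₀ : q₀.2.1 = Φ q₀.1 - Φ x₀ := by
    rw [sub_eq_zero] at hu0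
    rw [← hu0]; abel
  have hval : ψ q₀.1 + ε * ‖q₀.1 - x₀‖ ^ 2 + q₀.2.2 ≤ ψ x₀ := by
    refine le_of_tendsto (hψl.add hl3) ?_
    filter_upwards [hCpos] with C hC
    have h1 := hlt C
    have : 0 ≤ penalty ε C 0 (Φ x₀ + (q C).2.1 - Φ (q C).1) := by unfold penalty; positivity
    linarith
  have hge := (hball _ hx₀).2.2.2.2 q₀.2.2 (by rw [← hd₀]; exact hq₀.2)
  have hx0 : q₀.1 = x₀ := by
    have : ε * ‖q₀.1 - x₀‖ ^ 2 ≤ 0 := by linarith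
    have h2 : ‖q₀.1 - x₀‖ ^ 2 ≤ 0 := by
      by_contra hc
      exact absurd this (not_le.2 (mul_pos hε (not_le.1 hc)))
    exact sub_eq_zero.1 (norm_eq_zero.1
      (pow_eq_zero_iff two_ne_zero |>.1 (le_antisymm h2 (by positivity))))
  have hd0 : q₀.2.1 = 0 := by rw [hd₀, hx0, sub_self]
  have hs0' : q₀.2.2 = 0 := by
    refine le_antisymm ?_ (hE.nonneg _ hq₀.2)
    rw [hx0] at hval
    simpa using hval
  have hq₀' : q₀ = (x₀, 0, 0) := Prod.ext hx0 (Prod.ext hd0 hs0')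
  rw [hx0] at hl1
  rw [hd0] at hl2
  have hint : ∀ᶠ C in (𝒰 : Filter ℝ), q C ∈ Metric.ball (x₀, (0 : Y), (0 : ℝ)) r := by
    rw [hq₀'] at hlim
    exact hlim.eventually (Metric.ball_mem_nhds _ hr)
  -- A zero violation would make the point truly feasible, and its value below `ψ x₀` would
  -- contradict `hmin`.
  have hune : ∀ C, 0 < C → Φ x₀ + (q C).2.1 - Φ (q C).1 ≠ 0 := by
    intro C hC h0
    have h1 := hlt C
    have h2 : (q C).2.1 = Φ (q C).1 - Φ x₀ := by
      rw [sub_eq_zero] at h0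
      rw [← h0]; abel
    have h3 := (hball _ (hfst _ (hq C))).2.2.2.2 (q C).2.2 (by rw [← h2]; exact (hq C).2)
    have : 0 ≤ penalty ε C 0 (Φ x₀ + (q C).2.1 - Φ (q C).1) := by unfold penalty; positivity
    have : 0 ≤ ε * ‖(q C).1 - x₀‖ ^ 2 := by positivity
    linarith
  set v : ℝ → Y := fun C => -((ε / √(‖Φ x₀ + (q C).2.1 - Φ (q C).1‖ ^ 2 + 0 ^ 2) + 2 * C) •
    (Φ x₀ + (q C).2.1 - Φ (q C).1)) with hv
  have hstat : ∀ᶠ C in (𝒰 : Filter ℝ),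
      (g (q C).1 + (2 * ε) • ((q C).1 - x₀)) + (A (q C).1).adjoint (v C) = 0 ∧
        ∀ p ∈ E, (q C).2.2 + ⟪v C, p.1 - (q C).2.1⟫ ≤ p.2 := by
    filter_upwards [hint, hCpos] with C hC hC0
    exact stationary_of_feasible_minimizer hE (hq C) hC (hψd _ (hfst _ (hq C)))
      (hball _ (hfst _ (hq C))).2.1
      (by have := norm_pos_iff.2 (hune C hC0); positivity) (hqmin C) rfl
  have hv0 : Tendsto v 𝒰 (𝓝 0) := by
    refine tendsto_multiplier hE hS.differentiableAt.continuousAt hU hl1 hl2 ?_ ?_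
    · filter_upwards [hstat] with C hC using ⟨_, (hq C).2, hC.2⟩
    · have hgl : Tendsto (fun C => -(g (q C).1 + (2 * ε) • ((q C).1 - x₀))) 𝒰 (𝓝 0) := by
        have h1 : Tendsto (fun C => g (q C).1) 𝒰 (𝓝 0) := by
          rw [← hS.stationary]
          exact hS.hess.continuousAt.tendsto.comp hl1
        simpa using (h1.add ((hl1.sub_const x₀).const_smul (2 * ε))).neg
      refine hgl.congr' ?_
      filter_upwards [hstat] with C hC using neg_eq_of_add_eq_zero_right hC.1
  -- The norm term of the penalty keeps the multipliers large: `‖v C‖ = ε + 2 * C * ‖u‖ > ε` for the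
  -- violation `u`, although `v` tends to 0.
  have hcontra : ∀ᶠ C in (𝒰 : Filter ℝ), False := by
    filter_upwards [hCpos, (tendsto_zero_iff_norm_tendsto_zero.1 hv0).eventually
      (gt_mem_nhds hε)] with C hC hlt
    have hun := norm_pos_iff.2 (hune C hC)
    rw [hv] at hlt
    simp only [norm_neg, norm_smul] at hlt
    rw [hsq0, Real.norm_of_nonneg (by positivity), add_mul, div_mul_cancel₀ _ hun.ne'] at hlt
    have : 0 < 2 * C * ‖Φ x₀ + (q C).2.1 - Φ (q C).1‖ := by positivity
    linarith
  exact hcontra.exists.elim fun _ h => h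

end Model

/-! ### Second-order conditions and isolated calmness for the localized model -/

section Model

variable {X Y ι : Type*} [NormedAddCommGroup X] [InnerProductSpace ℝ X] [CompleteSpace X]
  [NormedAddCommGroup Y] [InnerProductSpace ℝ Y]
  {ψ : X → ℝ} {g : X → X} {H : X →L[ℝ] X} {Φ : X → Y} {A : X → X →L[ℝ] Y} {x₀ : X}
  {E : Set (Y × ℝ)} {a : ι → Y} {c β : ι → ℝ}

/-- The second-order sufficient condition implies that `x₀` is a strict local minimizer of an
exactly penalized problem. -/
theorem eventually_eq_of_penalized_le [FiniteDimensional ℝ X]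
    (hS : SmoothData ψ g H Φ A x₀) (hE : LocalEpi E a c β)
    (hsosc : ∀ u, u ≠ 0 → A x₀ u ∈ activeCone a β → 0 < ⟪H u, u⟫) :
    ∀ᶠ q : X × Y × ℝ in 𝓝 (x₀, 0, 0), q.2 ∈ E →
      ψ q.1 + q.2.2 + ‖Φ x₀ + q.2.1 - Φ q.1‖ ≤ ψ x₀ → q.1 = x₀ := by
  by_contra hcon
  obtain ⟨𝒰, h𝒰, hbad⟩ := exists_ultrafilter_of_not_eventually hcon
  push Not at hbad
  have hx : Tendsto (fun q : X × Y × ℝ => q.1) 𝒰 (𝓝 x₀) :=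
    (continuous_fst.tendsto (x₀, (0 : Y), (0 : ℝ))).mono_left h𝒰
  set t : X × Y × ℝ → ℝ := fun q => ‖q.1 - x₀‖ with ht
  have htpos : ∀ᶠ q in (𝒰 : Filter (X × Y × ℝ)), 0 < t q := by
    filter_upwards [hbad] with q hq using norm_pos_iff.2 (sub_ne_zero.2 hq.2.2)
  have ht0 : Tendsto t 𝒰 (𝓝 0) := by
    simpa using (hx.sub_const x₀).norm
  obtain ⟨h, hh1, hh⟩ := exists_tendsto_of_eventually_mem 𝒰 (isCompact_sphere (0 : X) 1)
    (f := fun q => (t q)⁻¹ • (q.1 - x₀)) (by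
      filter_upwards [htpos] with q hq
      rw [mem_sphere_zero_iff_norm, norm_smul, norm_inv, Real.norm_of_nonneg hq.le]
      exact inv_mul_cancel₀ hq.ne')
  have hhne : h ≠ 0 := by
    rintro rfl
    simp at hh1
  have hψ := hS.tendsto_blowup_sq hx hh
  -- The height and the violation are nonnegative with sum at most `ψ x₀ - ψ q.1 = O(t ^ 2)`. Both
  -- are therefore `o(t)`, and the limit direction is critical.
  have hψt : Tendsto (fun q : X × Y × ℝ => (t q)⁻¹ * (ψ x₀ - ψ q.1)) 𝒰 (𝓝 0) := by
    have := (hψ.mul ht0).neg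
    rw [mul_zero, neg_zero] at this
    refine this.congr' ?_
    filter_upwards [htpos] with q hq
    field_simp
    ring
  have hs : Tendsto (fun q : X × Y × ℝ => (t q)⁻¹ * q.2.2) 𝒰 (𝓝 0) := by
    refine tendsto_of_tendsto_of_tendsto_of_le_of_le' tendsto_const_nhds hψt ?_ ?_
    · filter_upwards [htpos, hbad] with q hq hb
      exact mul_nonneg (inv_nonneg.2 hq.le) (hE.nonneg _ hb.1)
    · filter_upwards [htpos, hbad] with q hq hb
      refine mul_le_mul_of_nonneg_left ?_ (inv_nonneg.2 hq.le)
      have := hb.2.1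
      have := norm_nonneg (Φ x₀ + q.2.1 - Φ q.1)
      linarith
  have hu : Tendsto (fun q : X × Y × ℝ => (t q)⁻¹ • (Φ x₀ + q.2.1 - Φ q.1)) 𝒰 (𝓝 0) := by
    refine squeeze_zero_norm' ?_ hψt
    filter_upwards [htpos, hbad] with q hq hb
    rw [norm_smul, norm_inv, Real.norm_of_nonneg hq.le]
    refine mul_le_mul_of_nonneg_left ?_ (inv_nonneg.2 hq.le)
    have := hb.2.1
    have := hE.nonneg _ hb.1
    linarith
  have hd : Tendsto (fun q : X × Y × ℝ => (t q)⁻¹ • q.2.1) 𝒰 (𝓝 (A x₀ h)) := by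
    have := (HasFDerivAt.tendsto_blowup hS.hasFDerivAt_self hx hh).add hu
    rw [add_zero] at this
    refine this.congr fun q => ?_
    rw [← smul_add]
    congr 1
    abel
  have hcone := hE.mem_activeCone_of_tendsto (hbad.mono fun q hq => hq.1) htpos hd hs
  have hpos := hsosc h hhne hcone
  have hle : 1 / 2 * ⟪H h, h⟫ ≤ 0 := by
    refine le_of_tendsto hψ ?_
    filter_upwards [hbad] with q hb
    refine mul_nonpos_of_nonneg_of_nonpos (by positivity) ?_
    have := hb.2.1
    have := hE.nonneg _ hb.1
    have := norm_nonneg (Φ x₀ + q.2.1 - Φ q.1)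
    linarith
  linarith

variable [CompleteSpace Y]

/-- Second-order necessary condition at a local minimizer with a unique multiplier. -/
theorem inner_hess_nonneg [FiniteDimensional ℝ X] [FiniteDimensional ℝ Y] [Finite ι]
    (hS : SmoothData ψ g H Φ A x₀) (hE : LocalEpi E a c β) (hU : UniqueMultiplier E (A x₀))
    (hmin : ∀ᶠ x in 𝓝 x₀, ∀ s, (Φ x - Φ x₀, s) ∈ E → ψ x₀ ≤ ψ x + s) {u : X}
    (hu : A x₀ u ∈ activeCone a β) : 0 ≤ ⟪H u, u⟫ := by
  obtain ⟨M, hMpos, hM⟩ := (isBigO_firstOrder hS.hasFDerivAt hS.differentiableAt).exists_pos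
  have hline := tendsto_line (x₀ := x₀) u
  have hM' := hline.eventually hM.bound
  -- The two summands come from `ε * ‖x - x₀‖ ^ 2` and from `ε` times the norm of the violation.
  set B : ℝ := ‖u‖ ^ 2 + M * ‖u‖ ^ 2 with hB
  have key : ∀ ε : ℝ, 0 < ε → 0 ≤ 1 / 2 * ⟪H u, u⟫ + ε * B := by
    intro ε hε
    obtain ⟨C, hC⟩ := exists_penalty_bound hS hE hU hmin hε
    -- Along this straight line the violation is `O(t ^ 2)`: its norm costs `ε * O(t ^ 2)` and its
    -- square only `O(t ^ 4)`, so `C` drops out after division by `t ^ 2`.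
    have hcurve : Tendsto (fun t : ℝ => (x₀ + t • u, t • A x₀ u, (0 : ℝ))) (𝓝[>] 0)
        (𝓝 (x₀, 0, 0)) := by
      refine hline.prodMk_nhds (Tendsto.prodMk_nhds ?_ tendsto_const_nhds)
      simpa using tendsto_line (x₀ := (0 : Y)) (A x₀ u)
    have hC' := hcurve.eventually hC
    have hl1 := hS.tendsto_blowup_sq hline (tendsto_line_blowup u)
    have hsq : Tendsto (fun t : ℝ => |C| * (M * ‖u‖ ^ 2) ^ 2 * t ^ 2) (𝓝[>] 0) (𝓝 0) := by
      have : Continuous (fun t : ℝ => |C| * (M * ‖u‖ ^ 2) ^ 2 * t ^ 2) := by fun_prop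
      simpa using (this.tendsto 0).mono_left (nhdsWithin_le_nhds (s := Set.Ioi 0))
    have hl2 := (hl1.add_const (ε * B)).add hsq
    rw [add_zero] at hl2
    refine ge_of_tendsto hl2 ?_
    filter_upwards [hC', hM', hE.eventually_smul_mem hu, self_mem_nhdsWithin] with t h1 h2 h3 ht
    have ht0 : (0 : ℝ) < t := ht
    have h4 := h1 h3
    simp only [add_sub_cancel_left, add_zero] at h4 h2
    rw [norm_smul, Real.norm_of_nonneg ht0.le, norm_pow, norm_mul, norm_norm,
      Real.norm_of_nonneg ht0.le, map_smul] at h2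
    have h5 : ‖Φ x₀ + t • A x₀ u - Φ (x₀ + t • u)‖ ≤ M * ‖u‖ ^ 2 * t ^ 2 := by
      rw [← norm_neg]
      calc _ = ‖Φ (x₀ + t • u) - Φ x₀ - t • A x₀ u‖ := by congr 1; abel
        _ ≤ _ := h2
        _ = _ := by ring
    rw [penalty, zero_pow two_ne_zero, add_zero, Real.sqrt_sq (norm_nonneg _), norm_smul,
      Real.norm_of_nonneg ht0.le] at h4
    have h6 : C * ‖Φ x₀ + t • A x₀ u - Φ (x₀ + t • u)‖ ^ 2 ≤
        |C| * (M * ‖u‖ ^ 2 * t ^ 2) ^ 2 := by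
      calc _ ≤ |C| * ‖Φ x₀ + t • A x₀ u - Φ (x₀ + t • u)‖ ^ 2 := by
            gcongr; exact le_abs_self C
        _ ≤ _ := by gcongr
    have h7 := mul_le_mul_of_nonneg_left h5 hε.le
    have h8 : 0 ≤ (ψ (x₀ + t • u) - ψ x₀) + ε * B * t ^ 2 +
        |C| * (M * ‖u‖ ^ 2) ^ 2 * t ^ 2 * t ^ 2 := by
      rw [hB]
      linarith
    have h9 : t⁻¹ ^ 2 * (ψ (x₀ + t • u) - ψ x₀) + ε * B + |C| * (M * ‖u‖ ^ 2) ^ 2 * t ^ 2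
        = t⁻¹ ^ 2 * ((ψ (x₀ + t • u) - ψ x₀) + ε * B * t ^ 2 +
          |C| * (M * ‖u‖ ^ 2) ^ 2 * t ^ 2 * t ^ 2) := by
      field_simp
    rw [h9]
    positivity
  have hlim : Tendsto (fun ε : ℝ => 1 / 2 * ⟪H u, u⟫ + ε * B) (𝓝[>] 0)
      (𝓝 (1 / 2 * ⟪H u, u⟫)) := by
    have : Continuous (fun ε : ℝ => 1 / 2 * ⟪H u, u⟫ + ε * B) := by fun_prop
    simpa using (this.tendsto 0).mono_left (nhdsWithin_le_nhds (s := Set.Ioi 0))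
  have := ge_of_tendsto hlim (by
    filter_upwards [self_mem_nhdsWithin] with ε hε using key ε hε)
  linarith

/-- At a local minimizer with a unique noncritical multiplier the second-order sufficient condition
holds. -/
theorem inner_hess_pos_of_noncritical [FiniteDimensional ℝ X] [FiniteDimensional ℝ Y] [Fintype ι]
    (hS : SmoothData ψ g H Φ A x₀) (hE : LocalEpi E a c β) (hU : UniqueMultiplier E (A x₀))
    (hmin : ∀ᶠ x in 𝓝 x₀, ∀ s, (Φ x - Φ x₀, s) ∈ E → ψ x₀ ≤ ψ x + s)
    (hnc : ∀ ξ η, H ξ + (A x₀).adjoint η = 0 →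
      (∀ᶠ t : ℝ in 𝓝[>] 0, IsSubgrad E (t • A x₀ ξ) (t • η)) → ξ = 0)
    {u : X} (hu0 : u ≠ 0) (hu : A x₀ u ∈ activeCone a β) : 0 < ⟪H u, u⟫ := by
  classical
  refine lt_of_le_of_ne (inner_hess_nonneg hS hE hU hmin hu) fun heq => hu0 ?_
  -- Only active constraints that are tight at `u` restrict small moves away from `u` within the
  -- critical directions.
  set J : Finset ι := Finset.univ.filter fun i => β i = 0 ∧ ⟪a i, A x₀ u⟫ = 0 with hJ
  -- First-order condition at `u`, a minimizer with value 0 of the quadratic form over those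
  -- directions.
  have hpolar : ∀ d, (∀ i ∈ J, ⟪a i, A x₀ d⟫ ≤ 0) → -⟪H u, d⟫ ≤ 0 := by
    intro d hd
    have hcone : ∀ᶠ t : ℝ in 𝓝[>] 0, A x₀ (u + t • d) ∈ activeCone a β := by
      simp only [activeCone, Set.mem_ofPred_eq]
      rw [Filter.eventually_all]
      intro i
      by_cases hi : β i = 0
      · rcases (hu i hi).eq_or_lt with h | h
        · filter_upwards [self_mem_nhdsWithin] with t ht _
          have := hd i (by simp [hJ, hi, h])
          rw [map_add, map_smul, inner_add_right, real_inner_smul_right, h, zero_add]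
          exact mul_nonpos_of_nonneg_of_nonpos (le_of_lt ht) this
        · have : Tendsto (fun t : ℝ => ⟪a i, A x₀ (u + t • d)⟫) (𝓝[>] 0)
              (𝓝 ⟪a i, A x₀ u⟫) :=
            tendsto_const_nhds.inner (((A x₀).continuous.tendsto u).comp (tendsto_line d))
          filter_upwards [this.eventually (gt_mem_nhds h)] with t ht _ using ht.le
      · exact Eventually.of_forall fun t h => absurd h hi
    have hlim : Tendsto (fun t : ℝ => 2 * ⟪H u, d⟫ + t * ⟪H d, d⟫) (𝓝[>] 0)
        (𝓝 (2 * ⟪H u, d⟫)) := by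
      have : Continuous (fun t : ℝ => 2 * ⟪H u, d⟫ + t * ⟪H d, d⟫) := by fun_prop
      simpa using (this.tendsto 0).mono_left (nhdsWithin_le_nhds (s := Set.Ioi 0))
    have := ge_of_tendsto (b := 0) hlim (by
      filter_upwards [hcone, self_mem_nhdsWithin] with t ht ht0
      have h1 := inner_hess_nonneg hS hE hU hmin ht
      simp only [map_add, map_smul, inner_add_left, inner_add_right, real_inner_smul_left,
        real_inner_smul_right, ← heq, hS.symm d u] at h1
      have h2 : 0 ≤ t * (2 * ⟪H u, d⟫ + t * ⟪H d, d⟫) := by linarith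
      exact nonneg_of_mul_nonneg_right h2 ht0)
    linarith
  obtain ⟨ν, hν, hsum⟩ := exists_nonneg_sum_of_farkas J
    (fun i => (innerₗ Y (a i)).comp (A x₀).toLinearMap) (-innerₗ X (H u))
    (fun d hd => by simpa using hpolar d (fun i hi => by simpa using hd i hi))
  refine hnc u (∑ i ∈ J, ν i • a i) ?_ ?_
  · refine ext_inner_right ℝ fun d => ?_
    have := LinearMap.congr_fun hsum d
    simp only [LinearMap.neg_apply, innerₗ_apply_apply, LinearMap.sum_apply, LinearMap.smul_apply,
      LinearMap.comp_apply, ContinuousLinearMap.coe_coe, smul_eq_mul] at this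
    rw [inner_add_left, ContinuousLinearMap.adjoint_inner_left, sum_inner, inner_zero_left]
    simp only [real_inner_smul_left]
    rw [← this]
    ring
  · obtain ⟨τ, hτ, h⟩ := hE.inner_sum_le (J := J)
      (fun i hi => by simp only [hJ, Finset.mem_filter] at hi; exact hi.2.1) hν
    -- Complementarity: it makes `t • η` a subgradient at `t • A x₀ u`, and not merely at the
    -- origin.
    have h0 : ⟪∑ i ∈ J, ν i • a i, A x₀ u⟫ = 0 := by
      rw [sum_inner]
      refine Finset.sum_eq_zero fun i hi => ?_
      simp only [hJ, Finset.mem_filter] at hi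
      rw [real_inner_smul_left, hi.2.2, mul_zero]
    filter_upwards [hE.eventually_smul_mem hu, Ioc_mem_nhdsGT hτ] with t ht1 ht2
    refine ⟨0, ht1, fun q hq => ?_⟩
    rw [inner_sub_right, real_inner_smul_left _ (t • _), real_inner_smul_right, h0]
    have := h t ht2.1.le ht2.2 q hq
    linarith

/-- Isolated calmness of the perturbed stationarity system under the second-order sufficient
condition and uniqueness of the multiplier. -/
theorem exists_calm_of_sosc [FiniteDimensional ℝ X] [FiniteDimensional ℝ Y] [Fintype ι]
    (hS : SmoothData ψ g H Φ A x₀) (hE : LocalEpi E a c β) (hU : UniqueMultiplier E (A x₀))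
    (hsosc : ∀ u, u ≠ 0 → A x₀ u ∈ activeCone a β → 0 < ⟪H u, u⟫) :
    ∃ ℓ : ℝ, 0 ≤ ℓ ∧ ∀ᶠ w : (X × Y) × (X × Y) in 𝓝 ((0, 0), (x₀, 0)),
      g w.2.1 + (A w.2.1).adjoint w.2.2 = w.1.1 →
      IsSubgrad E (Φ w.2.1 + w.1.2 - Φ x₀) w.2.2 → ‖(w.2.1 - x₀, w.2.2)‖ ≤ ℓ * ‖w.1‖ := by
  -- The constant becomes a variable tending to infinity, so a single ultrafilter carries the
  -- sequence of counterexamples.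
  suffices hmain : ∀ᶠ k : ℝ × ((X × Y) × (X × Y)) in atTop ×ˢ 𝓝 ((0, 0), (x₀, 0)),
      g k.2.2.1 + (A k.2.2.1).adjoint k.2.2.2 = k.2.1.1 →
      IsSubgrad E (Φ k.2.2.1 + k.2.1.2 - Φ x₀) k.2.2.2 →
        ‖(k.2.2.1 - x₀, k.2.2.2)‖ ≤ k.1 * ‖k.2.1‖ by
    obtain ⟨ℓ, h, hℓ⟩ := (hmain.curry.and (eventually_ge_atTop (0 : ℝ))).exists
    exact ⟨ℓ, hℓ, h⟩
  by_contra hcon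
  obtain ⟨𝒰, h𝒰, hbad⟩ := exists_ultrafilter_of_not_eventually hcon
  push Not at hbad
  have hℓ : Tendsto (fun k : ℝ × ((X × Y) × (X × Y)) => k.1) 𝒰 atTop :=
    tendsto_fst.mono_left h𝒰
  have hw : Tendsto (fun k : ℝ × ((X × Y) × (X × Y)) => k.2) 𝒰 (𝓝 ((0, 0), (x₀, 0))) :=
    tendsto_snd.mono_left h𝒰
  have hp : Tendsto (fun k : ℝ × ((X × Y) × (X × Y)) => k.2.1) 𝒰 (𝓝 (0, 0)) :=
    (continuous_fst.tendsto _).comp hw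
  have hx : Tendsto (fun k : ℝ × ((X × Y) × (X × Y)) => k.2.2.1) 𝒰 (𝓝 x₀) :=
    ((continuous_fst.comp continuous_snd).tendsto _).comp hw
  have hv : Tendsto (fun k : ℝ × ((X × Y) × (X × Y)) => k.2.2.2) 𝒰 (𝓝 0) :=
    ((continuous_snd.comp continuous_snd).tendsto _).comp hw
  set t : ℝ × ((X × Y) × (X × Y)) → ℝ := fun k => ‖(k.2.2.1 - x₀, k.2.2.2)‖ with ht
  have htpos : ∀ᶠ k in (𝒰 : Filter _), 0 < t k := by
    filter_upwards [hbad, hℓ.eventually_ge_atTop 0] with k hk hk0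
    exact (mul_nonneg hk0 (norm_nonneg _)).trans_lt hk.2.2
  have hp0 : Tendsto (fun k => (t k)⁻¹ • k.2.1) 𝒰 (𝓝 0) := by
    refine squeeze_zero_norm' ?_ (tendsto_inv_atTop_zero.comp hℓ)
    filter_upwards [hbad, hℓ.eventually_gt_atTop 0, htpos] with k hk hk0 hkt
    rw [norm_smul, norm_inv, Real.norm_of_nonneg hkt.le, Function.comp_apply,
      inv_mul_le_iff₀ hkt, ← div_eq_mul_inv, le_div_iff₀ hk0, mul_comm]
    exact hk.2.2.le
  obtain ⟨⟨ξ, η⟩, hnorm, hlim⟩ := exists_tendsto_of_eventually_mem 𝒰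
    (isCompact_sphere (0 : X × Y) 1) (f := fun k => (t k)⁻¹ • (k.2.2.1 - x₀, k.2.2.2)) (by
      filter_upwards [htpos] with k hk
      rw [mem_sphere_zero_iff_norm, norm_smul, norm_inv, Real.norm_of_nonneg hk.le]
      exact inv_mul_cancel₀ hk.ne')
  have hξ : Tendsto (fun k => (t k)⁻¹ • (k.2.2.1 - x₀)) 𝒰 (𝓝 ξ) :=
    (continuous_fst.tendsto _).comp hlim
  have hη : Tendsto (fun k => (t k)⁻¹ • k.2.2.2) 𝒰 (𝓝 η) :=
    (continuous_snd.tendsto _).comp hlim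
  have hp1 : Tendsto (fun k => (t k)⁻¹ • k.2.1.1) 𝒰 (𝓝 0) :=
    (continuous_fst.tendsto (0 : X × Y)).comp hp0
  have hp2 : Tendsto (fun k => (t k)⁻¹ • k.2.1.2) 𝒰 (𝓝 0) :=
    (continuous_snd.tendsto (0 : X × Y)).comp hp0
  have hΦl : Tendsto (fun k : ℝ × ((X × Y) × (X × Y)) => Φ k.2.2.1 + k.2.1.2 - Φ x₀) 𝒰
      (𝓝 0) := by
    have h1 := hS.hasFDerivAt_self.continuousAt.tendsto.comp hx
    have h2 := (continuous_snd.tendsto _).comp hp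
    simpa using (h1.add h2).sub_const (Φ x₀)
  have hd : Tendsto (fun k => (t k)⁻¹ • (Φ k.2.2.1 + k.2.1.2 - Φ x₀)) 𝒰 (𝓝 (A x₀ ξ)) := by
    have := (HasFDerivAt.tendsto_blowup hS.hasFDerivAt_self hx hξ).add hp2
    rw [add_zero] at this
    refine this.congr fun k => ?_
    rw [← smul_add]
    congr 1
    abel
  obtain ⟨s, hs⟩ := Filter.Eventually.choice (hbad.mono fun k hk => hk.2.1)
  -- Testing the subgradient inequality at the origin traps the height between 0 and the pairing of
  -- multiplier and displacement. As the multipliers tend to 0, the height is `o(t)`.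
  have hs1 : ∀ᶠ k in (𝒰 : Filter _), 0 ≤ s k ∧
      s k ≤ ⟪k.2.2.2, Φ k.2.2.1 + k.2.1.2 - Φ x₀⟫ := by
    filter_upwards [hs] with k hk
    refine ⟨hE.nonneg _ hk.1, ?_⟩
    have := hk.2 _ hE.zero_mem
    simp only [zero_sub, inner_neg_right] at this
    linarith
  have hs0 : Tendsto (fun k => (t k)⁻¹ * s k) 𝒰 (𝓝 0) := by
    have h1 := hv.inner (𝕜 := ℝ) hd
    rw [inner_zero_left] at h1
    refine tendsto_of_tendsto_of_tendsto_of_le_of_le' tendsto_const_nhds h1 ?_ ?_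
    · filter_upwards [htpos, hs1] with k hk hsk
      exact mul_nonneg (inv_nonneg.2 hk.le) hsk.1
    · filter_upwards [htpos, hs1] with k hk hsk
      rw [real_inner_smul_right]
      exact mul_le_mul_of_nonneg_left hsk.2 (inv_nonneg.2 hk.le)
  have hcone := hE.mem_activeCone_of_tendsto (hs.mono fun k hk => hk.1) htpos hd hs0
  have hmono : 0 ≤ ⟪η, A x₀ ξ⟫ := by
    refine ge_of_tendsto (hη.inner hd) ?_
    filter_upwards [htpos, hs1] with k hk hsk
    rw [real_inner_smul_right, real_inner_smul_left]
    have := inv_nonneg.2 hk.le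
    have := hsk.1.trans hsk.2
    positivity
  have hgrad : H ξ + (A x₀).adjoint η = 0 := by
    have h1 := HasFDerivAt.tendsto_blowup hS.hess hx hξ
    have h2 := tendsto_adjoint_apply (hS.differentiableAt.continuousAt.tendsto.comp hx) hη
    refine tendsto_nhds_unique ((h1.add h2).congr' ?_) hp1
    filter_upwards [hbad] with k hk
    rw [hS.stationary, sub_zero, ← hk.1, smul_add, Function.comp_apply, map_smul]
  -- Pairing the linearized equation with `ξ` gives `⟪H ξ, ξ⟫ = -⟪η, A x₀ ξ⟫ ≤ 0`, against SOSC at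
  -- the critical direction `ξ`.
  have hξ0 : ξ = 0 := by
    by_contra hne
    have h1 := hsosc ξ hne hcone
    have h2 : ⟪H ξ + (A x₀).adjoint η, ξ⟫ = 0 := by rw [hgrad, inner_zero_left]
    rw [inner_add_left, ContinuousLinearMap.adjoint_inner_left] at h2
    linarith
  subst hξ0
  rw [map_zero, zero_add] at hgrad
  -- Testing the subgradients at `(r • w, 0)` puts `η` in the polar of the active cone; a small
  -- multiple of `η` is then a subgradient at the origin, so uniqueness kills it.
  obtain ⟨τ, hτ, hτη⟩ := hE.exists_smul_inner_le_of_polar (η := η) (by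
    intro w hw'
    obtain ⟨r, hr, hr0⟩ := ((hE.eventually_smul_mem hw').and self_mem_nhdsWithin).exists
    have hr0' : (0 : ℝ) < r := hr0
    have h1 : ⟪η, r • w - 0⟫ ≤ 0 := by
      refine le_of_tendsto (hη.inner (tendsto_const_nhds.sub hΦl)) ?_
      filter_upwards [htpos, hs, hs1] with k hk hsk hsk1
      rw [real_inner_smul_left]
      refine mul_nonpos_of_nonneg_of_nonpos (inv_nonneg.2 hk.le) ?_
      have := hsk.2 _ hr
      simp only at this
      linarith [hsk1.1]
    rw [sub_zero, real_inner_smul_right] at h1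
    by_contra hc
    exact absurd h1 (not_le.2 (mul_pos hr0' (not_le.1 hc))))
  have h0 := hU (τ • η) hτη (by rw [map_smul, hgrad, smul_zero])
  have hη0 : η = 0 := (smul_eq_zero.1 h0).resolve_left hτ.ne'
  rw [hη0, mem_sphere_zero_iff_norm] at hnorm
  simp at hnorm

/-- Small multipliers of smoothed penalized problems yield, in the limit, an exact solution of the
stationarity system. -/
theorem exists_stationary_of_smoothing [FiniteDimensional ℝ X] [FiniteDimensional ℝ Y]
    (hE : LocalEpi E a c β) {r ρ : ℝ} {p : X × Y} {q : ℝ → X × Y × ℝ} {v : ℝ → Y}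
    (hball : ∀ x ∈ Metric.closedBall x₀ r, ContinuousAt Φ x ∧ ContinuousAt g x ∧ ContinuousAt A x)
    (hq : ∀ σ, q σ ∈ feasible x₀ r E)
    (hv : ∀ σ, v σ = -((1 / √(‖Φ x₀ - p.2 + (q σ).2.1 - Φ (q σ).1‖ ^ 2 + σ ^ 2) + 2 * 0) •
      (Φ x₀ - p.2 + (q σ).2.1 - Φ (q σ).1)))
    (hp : ∀ᶠ σ in 𝓝[>] 0, (g (q σ).1 - p.1 + (A (q σ).1).adjoint (v σ) = 0 ∧
      ∀ w ∈ E, (q σ).2.2 + ⟪v σ, w.1 - (q σ).2.1⟫ ≤ w.2) ∧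
      v σ ∈ Metric.closedBall 0 (min ρ (1 / 2)) ∧ (q σ).1 ∈ Metric.closedBall x₀ ρ) :
    ∃ x v, ‖x - x₀‖ ≤ ρ ∧ ‖v‖ ≤ ρ ∧ g x + (A x).adjoint v = p.1 ∧
      IsSubgrad E (Φ x + p.2 - Φ x₀) v := by
  have hK : IsCompact (feasible x₀ r E) :=
    (isCompact_closedBall _ _).inter_right (hE.isClosed.preimage continuous_snd)
  let 𝒱 : Ultrafilter ℝ := Ultrafilter.of (𝓝[>] 0)
  have h𝒱 : (𝒱 : Filter ℝ) ≤ 𝓝[>] 0 := Ultrafilter.of_le _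
  have hσpos : ∀ᶠ σ : ℝ in (𝒱 : Filter ℝ), 0 < σ := h𝒱 self_mem_nhdsWithin
  replace hp := hp.filter_mono h𝒱
  have hσ0 : Tendsto (fun σ : ℝ => σ) 𝒱 (𝓝 0) := h𝒱.trans nhdsWithin_le_nhds
  obtain ⟨q₀, hq₀, hlim⟩ := exists_tendsto_of_eventually_mem 𝒱 hK (f := q)
    (Eventually.of_forall hq)
  obtain ⟨v₀, hv₀, hvlim⟩ := exists_tendsto_of_eventually_mem 𝒱
    (isCompact_closedBall (0 : Y) (min ρ (1 / 2))) (f := v) (hp.mono fun σ h => h.2.1)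
  have hx₀ := fst_mem_of_mem_feasible hq₀
  have hl1 : Tendsto (fun σ => (q σ).1) 𝒱 (𝓝 q₀.1) := (continuous_fst.tendsto _).comp hlim
  have hl2 : Tendsto (fun σ => (q σ).2.1) 𝒱 (𝓝 q₀.2.1) :=
    ((continuous_fst.comp continuous_snd).tendsto _).comp hlim
  have hl3 : Tendsto (fun σ => (q σ).2.2) 𝒱 (𝓝 q₀.2.2) :=
    ((continuous_snd.comp continuous_snd).tendsto _).comp hlim
  have hul : Tendsto (fun σ => Φ x₀ - p.2 + (q σ).2.1 - Φ (q σ).1) 𝒱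
      (𝓝 (Φ x₀ - p.2 + q₀.2.1 - Φ q₀.1)) :=
    (hl2.const_add (Φ x₀ - p.2)).sub ((hball _ hx₀).1.tendsto.comp hl1)
  -- A multiplier of norm at most 1/2 means `‖u‖ ≤ √(‖u‖ ^ 2 + σ ^ 2) / 2`; letting `σ → 0` leaves
  -- `‖u‖ ≤ ‖u‖ / 2`.
  have hu0 : Φ x₀ - p.2 + q₀.2.1 - Φ q₀.1 = 0 := by
    have h1 : Tendsto (fun σ => √(‖Φ x₀ - p.2 + (q σ).2.1 - Φ (q σ).1‖ ^ 2 + σ ^ 2) * (1 / 2)) 𝒱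
        (𝓝 (√(‖Φ x₀ - p.2 + q₀.2.1 - Φ q₀.1‖ ^ 2 + 0 ^ 2) * (1 / 2))) :=
      (((hul.norm.pow 2).add (hσ0.pow 2)).sqrt).mul_const _
    have h2 := le_of_tendsto_of_tendsto hul.norm h1 (by
      filter_upwards [hp, hσpos] with σ hσ hσpos
      have h3 : ‖v σ‖ ≤ 1 / 2 := (mem_closedBall_zero_iff.1 hσ.2.1).trans (min_le_right _ _)
      have h4 : 0 < √(‖Φ x₀ - p.2 + (q σ).2.1 - Φ (q σ).1‖ ^ 2 + σ ^ 2) :=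
        Real.sqrt_pos.2 (by positivity)
      rw [hv] at h3
      simp only [mul_zero, add_zero, norm_neg, norm_smul] at h3
      rw [Real.norm_of_nonneg (by positivity), div_mul_eq_mul_div, one_mul, div_le_iff₀ h4,
        mul_comm] at h3
      exact h3)
    rw [zero_pow two_ne_zero, add_zero, Real.sqrt_sq (norm_nonneg _)] at h2
    have h3 := norm_nonneg (Φ x₀ - p.2 + q₀.2.1 - Φ q₀.1)
    exact norm_eq_zero.1 (by linarith)
  have hd₀ : q₀.2.1 = Φ q₀.1 + p.2 - Φ x₀ := by
    rw [sub_eq_zero] at hu0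
    rw [← hu0]; abel
  refine ⟨q₀.1, v₀, ?_, ?_, ?_, q₀.2.2, ?_, ?_⟩
  · refine le_of_tendsto (hl1.sub_const x₀).norm ?_
    filter_upwards [hp] with σ hσ
    simpa [dist_eq_norm] using hσ.2.2
  · exact (mem_closedBall_zero_iff.1 hv₀).trans (min_le_left _ _)
  · have h1 := ((hball _ hx₀).2.1.tendsto.comp hl1).sub_const p.1
    have h2 := tendsto_adjoint_apply ((hball _ hx₀).2.2.tendsto.comp hl1) hvlim
    have h3 := tendsto_nhds_unique ((h1.add h2).congr' (by
      filter_upwards [hp] with σ hσ using hσ.1.1)) tendsto_const_nhds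
    rw [sub_add_eq_add_sub, sub_eq_zero] at h3
    exact h3
  · rw [← hd₀]; exact hq₀.2
  · intro w hw
    rw [← hd₀]
    refine le_of_tendsto (hl3.add (hvlim.inner (hl2.const_sub w.1))) ?_
    filter_upwards [hp] with σ hσ using hσ.1.2 w hw

/-- Solvability of the perturbed stationarity system near the reference solution. -/
theorem eventually_exists_stationary [FiniteDimensional ℝ X] [FiniteDimensional ℝ Y]
    (hS : SmoothData ψ g H Φ A x₀) (hE : LocalEpi E a c β) (hU : UniqueMultiplier E (A x₀))
    (hgrow : ∀ᶠ q : X × Y × ℝ in 𝓝 (x₀, 0, 0), q.2 ∈ E →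
      ψ q.1 + q.2.2 + ‖Φ x₀ + q.2.1 - Φ q.1‖ ≤ ψ x₀ → q.1 = x₀) {ρ : ℝ} (hρ : 0 < ρ) :
    ∀ᶠ p : X × Y in 𝓝 0, ∃ x v, ‖x - x₀‖ ≤ ρ ∧ ‖v‖ ≤ ρ ∧ g x + (A x).adjoint v = p.1 ∧
      IsSubgrad E (Φ x + p.2 - Φ x₀) v := by
  obtain ⟨r₁, hr₁, hball₁⟩ := hS.exists_radius (P := fun _ => True) (by simp)
  obtain ⟨r₂, hr₂, hball₂⟩ := Metric.nhds_basis_closedBall.eventually_iff.1 hgrow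
  set r := min r₁ r₂ with hrdef
  have hr : 0 < r := lt_min hr₁ hr₂
  have hball : ∀ x ∈ Metric.closedBall x₀ r, HasGradientAt ψ (g x) x ∧ HasFDerivAt Φ (A x) x ∧
      ContinuousAt g x ∧ ContinuousAt A x := fun x hx => by
    have := hball₁ x (Metric.closedBall_subset_closedBall (min_le_left _ _) hx)
    exact ⟨this.1, this.2.1, this.2.2.1, this.2.2.2.1⟩
  have hΦc : ContinuousOn Φ (Metric.closedBall x₀ r) :=
    fun x hx => (hball x hx).2.1.continuousAt.continuousWithinAt
  have hψd : ∀ p : X, ∀ x ∈ Metric.closedBall x₀ r,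
      HasGradientAt (fun x => ψ x - ⟪p, x⟫) (g x - p) x := by
    intro p x hx
    have h1 : HasFDerivAt (fun x : X => ⟪p, x⟫) (innerSL ℝ p) x := (innerSL ℝ p).hasFDerivAt
    rw [hasGradientAt_iff_hasFDerivAt]
    refine ((hball x hx).1.hasFDerivAt.sub h1).congr_fderiv ?_
    ext w
    simp
  have hψc : ∀ p : X, ContinuousOn (fun x => ψ x - ⟪p, x⟫) (Metric.closedBall x₀ r) :=
    fun p x hx => (hψd p x hx).hasFDerivAt.continuousAt.continuousWithinAt
  choose q hq hqmin using fun k : (X × Y) × ℝ => exists_feasible_minimizer hE hr.le (hψc k.1.1) hΦc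
    (continuous_penalty 1 0 k.2) (Φ x₀ - k.1.2)
  have hqlim : Tendsto q (𝓝 0 ×ˢ 𝓝[>] 0) (𝓝 (x₀, 0, 0)) :=
    tendsto_penalized_minimizer hE hr (fun x hx => (hball x hx).1.hasFDerivAt.continuousAt)
      (fun x hx => (hball x hx).2.1.continuousAt)
      (fun q hq => hball₂ (Metric.closedBall_subset_closedBall (min_le_right _ _) hq.1) hq.2)
      hq hqmin
  set l : Filter ((X × Y) × ℝ) := 𝓝 0 ×ˢ 𝓝[>] 0 with hl
  have hlp1 : Tendsto (fun k : (X × Y) × ℝ => k.1.1) l (𝓝 0) :=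
    (continuous_fst.tendsto (0 : X × Y)).comp tendsto_fst
  set v : (X × Y) × ℝ → Y := fun k =>
    -((1 / √(‖Φ x₀ - k.1.2 + (q k).2.1 - Φ (q k).1‖ ^ 2 + k.2 ^ 2) + 2 * 0) •
      (Φ x₀ - k.1.2 + (q k).2.1 - Φ (q k).1)) with hv
  have hσpos : ∀ᶠ k in l, 0 < k.2 :=
    (tendsto_snd (f := 𝓝 (0 : X × Y)) (g := 𝓝[>] (0 : ℝ))).eventually self_mem_nhdsWithin
  have hstat : ∀ᶠ k in l, (g (q k).1 - k.1.1) + (A (q k).1).adjoint (v k) = 0 ∧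
      ∀ p ∈ E, (q k).2.2 + ⟪v k, p.1 - (q k).2.1⟫ ≤ p.2 := by
    filter_upwards [hqlim.eventually (Metric.ball_mem_nhds _ hr), hσpos] with k hk hk0
    have hx := fst_mem_of_mem_feasible (hq k)
    exact stationary_of_feasible_minimizer hE (hq k) hk (hψd k.1.1 _ hx)
      (hball _ hx).2.1 (by positivity) (hqmin k) rfl
  have hxl : Tendsto (fun k => (q k).1) l (𝓝 x₀) := (continuous_fst.tendsto _).comp hqlim
  have hdl : Tendsto (fun k => (q k).2.1) l (𝓝 0) :=
    ((continuous_fst.comp continuous_snd).tendsto _).comp hqlim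
  have hv0 : Tendsto v l (𝓝 0) := by
    refine tendsto_multiplier hE hS.differentiableAt.continuousAt hU hxl hdl ?_ ?_
    · filter_upwards [hstat] with k hk using ⟨_, (hq k).2, hk.2⟩
    · have hgl : Tendsto (fun k : (X × Y) × ℝ => -(g (q k).1 - k.1.1)) l (𝓝 0) := by
        have h1 : Tendsto (fun k => g (q k).1) l (𝓝 0) := by
          rw [← hS.stationary]
          exact hS.hess.continuousAt.tendsto.comp hxl
        simpa using (h1.sub hlp1).neg
      refine hgl.congr' ?_
      filter_upwards [hstat] with k hk using neg_eq_of_add_eq_zero_right hk.1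
  have hvball := hv0.eventually (Metric.closedBall_mem_nhds (0 : Y)
    (lt_min hρ (show (0 : ℝ) < 1 / 2 by norm_num)))
  have hxball := hxl.eventually (Metric.closedBall_mem_nhds x₀ hρ)
  -- Currying fixes `p` near 0 first and leaves `σ → 0` available for that `p`.
  have hall := (hstat.and (hvball.and hxball)).curry
  filter_upwards [hall] with p hp
  exact exists_stationary_of_smoothing hE (r := r) (q := fun σ => q (p, σ))
    (v := fun σ => v (p, σ))
    (fun x hx => ⟨(hball x hx).2.1.continuousAt, (hball x hx).2.2⟩) (fun σ => hq _)
    (fun σ => rfl) hp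

theorem tendsto_zero_of_blowup {Z α : Type*} [NormedAddCommGroup Z] [NormedSpace ℝ Z]
    {l : Filter α} {t : α → ℝ} {f : α → Z} {z : Z} (htpos : ∀ᶠ k in l, 0 < t k)
    (ht : Tendsto t l (𝓝 0)) (hf : Tendsto (fun k => (t k)⁻¹ • f k) l (𝓝 z)) :
    Tendsto f l (𝓝 0) := by
  have := ht.smul hf
  rw [zero_smul] at this
  refine this.congr' ?_
  filter_upwards [htpos] with k hk
  rw [smul_inv_smul₀ hk.ne']

/-- Isolated calmness of the perturbed stationarity system excludes critical directions. -/
theorem eq_zero_of_calm (hS : SmoothData ψ g H Φ A x₀) {ℓ : ℝ}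
    (hcalm : ∀ᶠ w : (X × Y) × (X × Y) in 𝓝 ((0, 0), (x₀, 0)),
      g w.2.1 + (A w.2.1).adjoint w.2.2 = w.1.1 →
      IsSubgrad E (Φ w.2.1 + w.1.2 - Φ x₀) w.2.2 → ‖(w.2.1 - x₀, w.2.2)‖ ≤ ℓ * ‖w.1‖)
    {ξ : X} {η : Y} (hξη : H ξ + (A x₀).adjoint η = 0) {α : Type*} {l : Filter α} [l.NeBot]
    {t : α → ℝ} {D : α → Y × Y} (htpos : ∀ᶠ k in l, 0 < t k) (ht : Tendsto t l (𝓝 0))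
    (hsub : ∀ᶠ k in l, IsSubgrad E (D k).1 (D k).2)
    (hD : Tendsto (fun k => (t k)⁻¹ • D k) l (𝓝 (A x₀ ξ, η))) : ξ = 0 := by
  have hx : Tendsto (fun k => x₀ + t k • ξ) l (𝓝 x₀) := by
    simpa using (ht.smul_const ξ).const_add x₀
  have hxb : Tendsto (fun k => (t k)⁻¹ • (x₀ + t k • ξ - x₀)) l (𝓝 ξ) := by
    refine tendsto_const_nhds.congr' ?_
    filter_upwards [htpos] with k hk
    rw [add_sub_cancel_left, inv_smul_smul₀ hk.ne']
  have hD1 : Tendsto (fun k => (t k)⁻¹ • (D k).1) l (𝓝 (A x₀ ξ)) :=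
    (continuous_fst.tendsto _).comp hD
  have hD2 : Tendsto (fun k => (t k)⁻¹ • (D k).2) l (𝓝 η) := (continuous_snd.tendsto _).comp hD
  -- The perturbation is the residual, so the perturbed system holds exactly; the linearized
  -- equation makes it `o(t)`, while the solution moves by at least `t * ‖ξ‖`.
  set p : α → X × Y := fun k => (g (x₀ + t k • ξ) + (A (x₀ + t k • ξ)).adjoint (D k).2,
    Φ x₀ + (D k).1 - Φ (x₀ + t k • ξ)) with hp
  have hp0 : Tendsto (fun k => (t k)⁻¹ • p k) l (𝓝 0) := by
    have h1 := HasFDerivAt.tendsto_blowup hS.hess hx hxb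
    have h2 := tendsto_adjoint_apply (hS.differentiableAt.continuousAt.tendsto.comp hx) hD2
    have h3 := hD1.sub (HasFDerivAt.tendsto_blowup hS.hasFDerivAt_self hx hxb)
    have h4 := (h1.add h2).prodMk_nhds h3
    rw [hξη, sub_self] at h4
    refine h4.congr fun k => ?_
    refine Prod.ext ?_ ?_
    · simp only [hp, Prod.smul_fst, Function.comp_apply, hS.stationary, sub_zero, smul_add,
        map_smul]
    · simp only [hp, Prod.smul_snd]
      rw [← smul_sub]
      congr 1
      abel
  have hw : Tendsto (fun k => (p k, (x₀ + t k • ξ, (D k).2))) l (𝓝 ((0, 0), (x₀, 0))) :=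
    (tendsto_zero_of_blowup htpos ht hp0).prodMk_nhds
      (hx.prodMk_nhds (tendsto_zero_of_blowup htpos ht hD2))
  have hle := le_of_tendsto_of_tendsto (tendsto_const_nhds (x := ‖ξ‖)) (hp0.norm.const_mul ℓ) (by
    filter_upwards [hw.eventually hcalm, hsub, htpos] with k hk hsk hkt
    have h1 := hk rfl (by
      have : Φ (x₀ + t k • ξ) + (Φ x₀ + (D k).1 - Φ (x₀ + t k • ξ)) - Φ x₀ = (D k).1 := by abel
      simp only [hp]
      rw [this]
      exact hsk)
    have h2 := (norm_fst_le _).trans h1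
    simp only [add_sub_cancel_left] at h2
    rw [norm_smul, Real.norm_of_nonneg hkt.le] at h2
    rw [norm_smul, norm_inv, Real.norm_of_nonneg hkt.le, mul_left_comm, le_inv_mul_iff₀ hkt]
    exact h2)
  rw [norm_zero, mul_zero] at hle
  exact norm_le_zero_iff.1 hle

end Model

/-! ### Reduction of convex piecewise linear functions to the localized model -/

section Reduction

variable {Y : Type*} [NormedAddCommGroup Y] [InnerProductSpace ℝ Y]

/-- The epigraph of `θ - ⟪v, ·⟫`, recentered at `z`. -/
def recenteredEpi (θ : Y → EReal) (z v : Y) : Set (Y × ℝ) :=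
  {q | θ (z + q.1) ≤ θ z + ((⟪v, q.1⟫ + q.2 : ℝ) : EReal)}

variable {θ : Y → EReal} {z v : Y} {r : ℝ}

theorem mem_recenteredEpi (hr : θ z = r) {d : Y} {s : ℝ} :
    (d, s) ∈ recenteredEpi θ z v ↔ θ (z + d) ≤ ((r + (⟪v, d⟫ + s) : ℝ) : EReal) := by
  simp [recenteredEpi, hr]

theorem mem_recenteredEpi_iff (hr : θ z = r) {d : Y} {s ρ : ℝ} (hρ : θ (z + d) = ρ) :
    (d, s) ∈ recenteredEpi θ z v ↔ ρ ≤ r + (⟪v, d⟫ + s) := by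
  rw [mem_recenteredEpi hr, hρ, EReal.coe_le_coe_iff]

theorem IsCPWL.exists_coe (hθ : IsCPWL θ) (hz : z ∈ effDom θ) : ∃ r : ℝ, θ z = r :=
  ⟨(θ z).toReal, (EReal.coe_toReal (ne_of_lt hz) (hθ.ne_bot z)).symm⟩

theorem mem_effDom_of_mem_recenteredEpi (hr : θ z = r) {d : Y} {s : ℝ}
    (h : (d, s) ∈ recenteredEpi θ z v) : z + d ∈ effDom θ :=
  ((mem_recenteredEpi hr).1 h).trans_lt (EReal.coe_lt_top _)

theorem nonneg_of_mem_recenteredEpi (hr : θ z = r) (hv : v ∈ subdiff θ z) {q : Y × ℝ}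
    (hq : q ∈ recenteredEpi θ z v) : 0 ≤ q.2 := by
  have h1 := (hv.2 (z + q.1)).trans ((mem_recenteredEpi hr).1 hq)
  rw [hr, add_sub_cancel_left, ← EReal.coe_add, EReal.coe_le_coe_iff] at h1
  linarith

/-- The recentered epigraph is the preimage of the polyhedron `epi θ` under `(d, s) ↦ (z + d, r +
⟪v, d⟫ + s)`, hence polyhedral. Slacks are nonnegative because `(z, r)` lies in `epi θ`. -/
theorem exists_localEpi [FiniteDimensional ℝ Y] (hθ : IsCPWL θ) (hv : v ∈ subdiff θ z) :
    ∃ (k : ℕ) (a : Fin k → Y) (c β : Fin k → ℝ), LocalEpi (recenteredEpi θ z v) a c β := by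
  obtain ⟨r, hr⟩ := hθ.exists_coe hv.1
  have := FiniteDimensional.complete ℝ Y
  obtain ⟨k, f, b, hf⟩ := hθ.epi_polyhedron
  let L : Fin k → (Y →ₗ[ℝ] ℝ) := fun i => (f i).comp (LinearMap.id.prod (innerₗ Y v))
  refine ⟨k, fun i => (InnerProductSpace.toDual ℝ Y).symm (LinearMap.toContinuousLinearMap (L i)),
    fun i => f i (0, 1), fun i => b i - f i (z, r), fun d s => ?_, fun i => ?_,
    fun q hq => nonneg_of_mem_recenteredEpi hr hv hq⟩
  · rw [mem_recenteredEpi hr]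
    have h1 : θ (z + d) ≤ ((r + (⟪v, d⟫ + s) : ℝ) : EReal) ↔
        (z + d, r + (⟪v, d⟫ + s)) ∈ epi θ := Iff.rfl
    rw [h1, hf]
    refine forall_congr' fun i => ?_
    have h2 : ((z + d, r + (⟪v, d⟫ + s)) : Y × ℝ) = (z, r) + (d, ⟪v, d⟫) + s • ((0 : Y), (1 : ℝ)) := by
      ext <;> simp [add_assoc]
    rw [h2, map_add, map_add, map_smul, InnerProductSpace.toDual_symm_apply]
    have h3 : (LinearMap.toContinuousLinearMap (L i)) d = f i (d, ⟪v, d⟫) := rfl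
    rw [h3, smul_eq_mul, mul_comm s]
    constructor <;> intro h <;> linarith
  · have : ((z, r) : Y × ℝ) ∈ epi θ := hr.le
    rw [hf] at this
    exact sub_nonneg.2 (this i)

/-- Removing the linear form of `v` from `θ` shifts all subgradients by `v`. -/
theorem add_mem_subdiff_iff (hθ : IsCPWL θ) (hr : θ z = r) {d v' : Y} :
    v + v' ∈ subdiff θ (z + d) ↔ IsSubgrad (recenteredEpi θ z v) d v' := by
  constructor
  · rintro ⟨hd, h⟩
    obtain ⟨ρ, hρ⟩ := hθ.exists_coe hd
    refine ⟨ρ - r - ⟪v, d⟫, (mem_recenteredEpi_iff hr hρ).2 (by linarith), fun q hq => ?_⟩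
    have h1 := (h (z + q.1)).trans ((mem_recenteredEpi hr).1 hq)
    rw [hρ, add_sub_add_left_eq_sub, ← EReal.coe_add, EReal.coe_le_coe_iff, inner_add_left,
      inner_sub_right v] at h1
    linarith
  · rintro ⟨s, hs, h⟩
    have hd := mem_effDom_of_mem_recenteredEpi hr hs
    obtain ⟨ρ, hρ⟩ := hθ.exists_coe hd
    refine ⟨hd, fun w => ?_⟩
    rcases eq_or_ne (θ w) ⊤ with hw | hw
    · rw [hw]; exact le_top
    · obtain ⟨τ, hτ⟩ := hθ.exists_coe (lt_top_iff_ne_top.2 hw)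
      have hw' : θ (z + (w - z)) = τ := by rw [add_sub_cancel, hτ]
      have h1 := h (w - z, τ - r - ⟪v, w - z⟫) ((mem_recenteredEpi_iff hr hw').2 (by linarith))
      have h2 := (mem_recenteredEpi_iff hr hρ).1 hs
      simp only at h1
      rw [hρ, hτ, ← EReal.coe_add, EReal.coe_le_coe_iff, ← sub_sub, inner_add_left,
        inner_sub_right v]
      linarith

theorem add_mem_subdiff_self_iff (hθ : IsCPWL θ) (hv : v ∈ subdiff θ z) {η : Y} :
    v + η ∈ subdiff θ z ↔ ∀ q ∈ recenteredEpi θ z v, ⟪η, q.1⟫ ≤ q.2 := by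
  obtain ⟨r, hr⟩ := hθ.exists_coe hv.1
  have h := add_mem_subdiff_iff (v := v) hθ hr (d := 0) (v' := η)
  rw [add_zero] at h
  rw [h]
  constructor
  · rintro ⟨s, hs, h⟩ q hq
    have h1 := h q hq
    have h2 := nonneg_of_mem_recenteredEpi hr hv hs
    simp only [sub_zero] at h1 h2
    linarith
  · intro h
    refine ⟨0, (mem_recenteredEpi_iff hr (by rw [add_zero, hr])).2 (by simp), fun q hq => ?_⟩
    simpa using h q hq

/-- Difference quotients are bounded below by `⟪v, u⟫`, and an excess of at most `e` means `(t • u,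
t * e)` lies in the recentered epigraph. Criticality thus asks for excess tending to 0; conversely,
the segment at height 0 attains the bound. -/
theorem criticalCone_eq_activeCone {ι : Type*} [Finite ι] {a : ι → Y} {c β : ι → ℝ}
    (hθ : IsCPWL θ) (hv : v ∈ subdiff θ z) (hE : LocalEpi (recenteredEpi θ z v) a c β) :
    criticalCone θ z v = activeCone a β := by
  obtain ⟨r, hr⟩ := hθ.exists_coe hv.1
  have hquot : ∀ (u : Y) (t e : ℝ), 0 < t →
      ((θ (z + t • u) - θ z) / (t : EReal) ≤ ((⟪v, u⟫ + e : ℝ) : EReal) ↔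
        (t • u, t * e) ∈ recenteredEpi θ z v) := by
    intro u t e ht
    rw [mem_recenteredEpi hr, EReal.div_le_iff_le_mul (EReal.coe_pos.2 ht) (EReal.coe_ne_top t),
      ← EReal.coe_mul, hr, EReal.sub_le_iff_le_add (Or.inl (EReal.coe_ne_bot _))
        (Or.inl (EReal.coe_ne_top _)), ← EReal.coe_add, real_inner_smul_right]
    have : t * (⟪v, u⟫ + e) + r = r + (t * ⟪v, u⟫ + t * e) := by ring
    rw [this]
  have hquot' : ∀ (u : Y) (t : ℝ), 0 < t →
      ((⟪v, u⟫ : ℝ) : EReal) ≤ (θ (z + t • u) - θ z) / (t : EReal) := by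
    intro u t ht
    rw [EReal.le_div_iff_mul_le (EReal.coe_pos.2 ht) (EReal.coe_ne_top t), ← EReal.coe_mul, hr]
    have h1 := hv.2 (z + t • u)
    rw [hr, add_sub_cancel_left, real_inner_smul_right] at h1
    rw [EReal.le_sub_iff_add_le (Or.inl (EReal.coe_ne_bot _)) (Or.inl (EReal.coe_ne_top _)),
      add_comm, mul_comm]
    exact h1
  have hpos : ∀ w : Y, ∀ᶠ p : Y × ℝ in 𝓝 w ×ˢ 𝓝[>] (0 : ℝ), 0 < p.2 := fun w =>
    tendsto_snd.eventually self_mem_nhdsWithin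
  ext w
  constructor
  · rintro ⟨-, heq⟩ i hi
    -- The margin `e` makes the bound on the liminf strict, so that it is met frequently.
    have key : ∀ e : ℝ, 0 < e → ∃ᶠ p : Y × ℝ in 𝓝 w ×ˢ 𝓝[>] (0 : ℝ),
        ⟪a i, p.1⟫ + c i * (⟪v, w⟫ + e - ⟪v, p.1⟫) ≤ 0 := by
      intro e he
      have h1 : subderiv θ z w < ((⟪v, w⟫ + e : ℝ) : EReal) := by
        rw [← heq, EReal.coe_lt_coe_iff]; linarith
      have h2 := frequently_lt_of_liminf_lt (by isBoundedDefault) h1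
      refine (h2.and_eventually (hpos w)).mono fun p hp => ?_
      have h3 := (hquot p.1 p.2 (⟪v, w⟫ + e - ⟪v, p.1⟫) hp.2).1 (by
        rw [add_sub_cancel]; exact hp.1.le)
      have h4 := (hE.mem_iff _ _).1 h3 i
      rw [hi, real_inner_smul_right] at h4
      have h5 : p.2 * (⟪a i, p.1⟫ + c i * (⟪v, w⟫ + e - ⟪v, p.1⟫)) ≤ 0 := by linarith
      by_contra hc
      exact absurd h5 (not_le.2 (mul_pos hp.2 (not_le.1 hc)))
    have key2 : ∀ e : ℝ, 0 < e → ⟪a i, w⟫ + c i * e ≤ 0 := by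
      intro e he
      have hlim : Tendsto (fun p : Y × ℝ => ⟪a i, p.1⟫ + c i * (⟪v, w⟫ + e - ⟪v, p.1⟫))
          (𝓝 w ×ˢ 𝓝[>] (0 : ℝ)) (𝓝 (⟪a i, w⟫ + c i * (⟪v, w⟫ + e - ⟪v, w⟫))) := by
        have : Continuous fun y : Y => ⟪a i, y⟫ + c i * (⟪v, w⟫ + e - ⟪v, y⟫) := by fun_prop
        exact (this.tendsto w).comp tendsto_fst
      have := le_of_tendsto_of_frequently hlim (key e he)
      rwa [add_sub_cancel_left] at this
    have hlim : Tendsto (fun e : ℝ => ⟪a i, w⟫ + c i * e) (𝓝[>] 0) (𝓝 ⟪a i, w⟫) := by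
      have : Continuous (fun e : ℝ => ⟪a i, w⟫ + c i * e) := by fun_prop
      simpa using (this.tendsto 0).mono_left (nhdsWithin_le_nhds (s := Set.Ioi 0))
    exact le_of_tendsto hlim (by filter_upwards [self_mem_nhdsWithin] with e he using key2 e he)
  · intro hw
    have hmem := hE.eventually_smul_mem hw
    refine ⟨?_, le_antisymm ?_ ?_⟩
    · refine mem_tangentConeAt_of_seq (𝓝[>] (0 : ℝ)) (fun t => (t⁻¹).toNNReal) (fun t => t • w)
        ?_ ?_ ?_
      · simpa using tendsto_line (x₀ := (0 : Y)) w
      · filter_upwards [hmem] with t ht using mem_effDom_of_mem_recenteredEpi hr ht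
      · refine tendsto_const_nhds.congr' ?_
        filter_upwards [self_mem_nhdsWithin] with t ht
        rw [NNReal.smul_def, Real.coe_toNNReal _ (inv_nonneg.2 (le_of_lt ht)),
          inv_smul_smul₀ (ne_of_gt ht)]
    · refine le_of_forall_lt fun y hy => ?_
      obtain ⟨y', hy1, hy2⟩ := exists_between hy
      refine hy1.trans_le (le_liminf_of_le (by isBoundedDefault) ?_)
      have hc : Continuous fun u : Y => ((⟪v, u⟫ : ℝ) : EReal) :=
        continuous_coe_real_ereal.comp (by fun_prop)
      have h1 : ∀ᶠ p : Y × ℝ in 𝓝 w ×ˢ 𝓝[>] (0 : ℝ), y' < ((⟪v, p.1⟫ : ℝ) : EReal) :=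
        tendsto_fst.eventually ((hc.tendsto w).eventually (lt_mem_nhds hy2))
      filter_upwards [h1, hpos w] with p hp hp0 using hp.le.trans (hquot' p.1 p.2 hp0)
    · refine liminf_le_of_frequently_le ?_ (by isBoundedDefault)
      have hcurve : Tendsto (fun t : ℝ => (w, t)) (𝓝[>] 0) (𝓝 w ×ˢ 𝓝[>] (0 : ℝ)) :=
        tendsto_const_nhds.prodMk tendsto_id
      refine hcurve.frequently (Eventually.frequently ?_)
      filter_upwards [hmem, self_mem_nhdsWithin] with t ht ht0
      have := (hquot w t 0 ht0).2 (by rwa [mul_zero])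
      rwa [add_zero] at this

/-- A tangent direction of a set, realized with step lengths tending to zero. -/
theorem exists_steps_of_mem_tangentConeAt.{u} {Z : Type u} [NormedAddCommGroup Z] [NormedSpace ℝ Z]
    {S : Set Z} {z y : Z} (hz : z ∈ S) (hy : y ∈ tangentConeAt ℝ≥0 S z) :
    ∃ (α : Type u) (l : Filter α) (_ : l.NeBot) (t : α → ℝ) (D : α → Z),
      (∀ᶠ k in l, 0 < t k) ∧ Tendsto t l (𝓝 0) ∧ (∀ᶠ k in l, z + D k ∈ S) ∧
        Tendsto (fun k => (t k)⁻¹ • D k) l (𝓝 y) := by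
  obtain ⟨α, l, hl, c, D, hD, hmem, hlim⟩ := exists_fun_of_mem_tangentConeAt hy
  by_cases hy0 : y = 0
  -- For `y = 0` the given scalars need not tend to infinity, so zero displacements with arbitrary
  -- vanishing steps are used instead.
  · refine ⟨ULift ℝ, comap ULift.down (𝓝[>] (0 : ℝ)), ?_, ULift.down, fun _ => 0, ?_, ?_, ?_, ?_⟩
    · exact NeBot.comap_of_surj inferInstance ULift.down_surjective
    · exact tendsto_comap.eventually self_mem_nhdsWithin
    · exact tendsto_comap.mono_right nhdsWithin_le_nhds
    · exact Eventually.of_forall fun _ => by simpa using hz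
    · simpa [hy0] using tendsto_const_nhds
  · have hc : ∀ᶠ k in l, 0 < (c k : ℝ) := by
      filter_upwards [hlim.eventually_ne hy0] with k hk
      refine lt_of_le_of_ne (c k).coe_nonneg fun h => hk ?_
      rw [NNReal.smul_def, ← h, zero_smul]
    refine ⟨α, l, hl, fun k => (c k : ℝ)⁻¹, D, ?_, ?_, hmem, ?_⟩
    · filter_upwards [hc] with k hk using inv_pos.2 hk
    -- The step `(c k)⁻¹` equals `‖D k‖ / ‖c k • D k‖`: the numerator vanishes and the denominator
    -- tends to `‖y‖ ≠ 0`.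
    · have h1 : Tendsto (fun k => ‖D k‖ / ‖c k • D k‖) l (𝓝 (‖(0 : Z)‖ / ‖y‖)) :=
        hD.norm.div hlim.norm (norm_ne_zero_iff.2 hy0)
      rw [norm_zero, zero_div] at h1
      refine h1.congr' ?_
      filter_upwards [hc, hlim.eventually_ne hy0] with k hk hk0
      have hDk : ‖D k‖ ≠ 0 := by
        rw [norm_ne_zero_iff]
        rintro h
        exact hk0 (by rw [h, smul_zero])
      rw [NNReal.smul_def, norm_smul, Real.norm_of_nonneg hk.le]
      field_simp
    · refine hlim.congr fun k => ?_
      rw [inv_inv, NNReal.smul_def]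

end Reduction

/-! ### Smoothness of the Lagrangian -/

section Lagrangian

variable {X Y : Type*} [NormedAddCommGroup X] [InnerProductSpace ℝ X] [CompleteSpace X]
  [NormedAddCommGroup Y] [InnerProductSpace ℝ Y]
  {φ₀ : X → ℝ} {Φ : X → Y} {x₀ : X}

theorem gradLagrangian_add [CompleteSpace Y] {x : X} (hφ₀ : DifferentiableAt ℝ φ₀ x) (hΦ : DifferentiableAt ℝ Φ x)
    (v v' : Y) : gradLagrangian φ₀ Φ x (v + v') =
      gradLagrangian φ₀ Φ x v + (fderiv ℝ Φ x).adjoint v' := by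
  have h1 : HasGradientAt (fun x' => lagrangian φ₀ Φ x' v) (gradLagrangian φ₀ Φ x v) x :=
    DifferentiableAt.hasGradientAt (hφ₀.add (hΦ.inner ℝ (differentiableAt_const v)))
  have h2 : HasFDerivAt (fun x' => ⟪v', Φ x'⟫) ((innerSL ℝ v').comp (fderiv ℝ Φ x)) x :=
    (innerSL ℝ v').hasFDerivAt.comp x hΦ.hasFDerivAt
  refine HasGradientAt.gradient ?_
  rw [hasGradientAt_iff_hasFDerivAt]
  have h3 : (fun x' => lagrangian φ₀ Φ x' (v + v')) =
      fun x' => lagrangian φ₀ Φ x' v + ⟪v', Φ x'⟫ := by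
    funext x'
    simp only [lagrangian, inner_add_right, real_inner_comm v' (Φ x')]
    ring
  rw [h3]
  refine (h1.hasFDerivAt.add h2).congr_fderiv ?_
  ext w
  simp [ContinuousLinearMap.adjoint_inner_left]

theorem smoothData_lagrangian [FiniteDimensional ℝ X] (hφ₀ : ContDiffAt ℝ 2 φ₀ x₀)
    (hΦ : ContDiffAt ℝ 2 Φ x₀) {v : Y} (hv : gradLagrangian φ₀ Φ x₀ v = 0) :
    SmoothData (fun x => lagrangian φ₀ Φ x v) (fun x => gradLagrangian φ₀ Φ x v)
      (hessLagrangian φ₀ Φ x₀ v) Φ (fderiv ℝ Φ) x₀ := by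
  have hψ : ContDiffAt ℝ 2 (fun x => lagrangian φ₀ Φ x v) x₀ :=
    hφ₀.add (hΦ.inner ℝ contDiffAt_const)
  have h2 : (2 : WithTop ℕ∞) ≠ ((⊤ : ℕ∞) : WithTop ℕ∞) := by decide
  -- The inverse Riesz map is conjugate-linear in general; over `ℝ` it is linear, so the gradient
  -- becomes a linear image of `fderiv`.
  let T : (X →L[ℝ] ℝ) →ₗ[ℝ] X :=
    { toFun := (InnerProductSpace.toDual ℝ X).symm
      map_add' := by simp
      map_smul' := by simp }
  let T' : (X →L[ℝ] ℝ) →L[ℝ] X := LinearMap.toContinuousLinearMap T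
  have hg : (fun x => gradLagrangian φ₀ Φ x v) =
      fun x => T' (fderiv ℝ (fun x => lagrangian φ₀ Φ x v) x) := rfl
  have hdiff : DifferentiableAt ℝ (fderiv ℝ (fun x => lagrangian φ₀ Φ x v)) x₀ :=
    (hψ.fderiv_right (m := 1) (by norm_num)).differentiableAt (by norm_num)
  have hess : HasFDerivAt (fun x => gradLagrangian φ₀ Φ x v) (hessLagrangian φ₀ Φ x₀ v) x₀ := by
    refine DifferentiableAt.hasFDerivAt ?_
    rw [hg]
    exact T'.differentiableAt.comp x₀ hdiff
  refine ⟨?_, ?_, ?_, ?_, hess, hv, ?_⟩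
  · filter_upwards [hψ.eventually h2] with x hx
    exact (hx.differentiableAt (by norm_num)).hasGradientAt
  · filter_upwards [hΦ.eventually h2] with x hx
    exact (hx.differentiableAt (by norm_num)).hasFDerivAt
  · filter_upwards [hψ.eventually h2, hΦ.eventually h2] with x hx hx'
    refine ⟨?_, (hx'.fderiv_right (m := 1) (by norm_num)).continuousAt⟩
    rw [hg]
    exact T'.continuous.continuousAt.comp (hx.fderiv_right (m := 1) (by norm_num)).continuousAt
  · exact (hΦ.fderiv_right (m := 1) (by norm_num)).differentiableAt (by norm_num)
  · have hH : ∀ u w, ⟪hessLagrangian φ₀ Φ x₀ v u, w⟫ =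
        fderiv ℝ (fderiv ℝ (fun x => lagrangian φ₀ Φ x v)) x₀ u w := by
      intro u w
      have h3 : hessLagrangian φ₀ Φ x₀ v =
          T'.comp (fderiv ℝ (fderiv ℝ (fun x => lagrangian φ₀ Φ x v)) x₀) := by
        refine hess.unique ?_
        rw [hg]
        exact T'.hasFDerivAt.comp x₀ hdiff.hasFDerivAt
      rw [h3]
      exact InnerProductSpace.toDual_symm_apply
    intro u w
    rw [hH, hH]
    exact (hψ.isSymmSndFDerivAt (by simp)).eq u w

end Lagrangian

/-! ### The composite problem in terms of the localized model -/

section Composite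

variable {X Y : Type*} [NormedAddCommGroup X] [NormedAddCommGroup Y] [InnerProductSpace ℝ Y]
  {φ₀ : X → ℝ} {Φ : X → Y} {θ : Y → EReal} {x₀ : X} {v : Y}

/-- The linear form added to `φ₀` in the Lagrangian is the one subtracted from `θ`, so the objective
changes only by a constant. -/
theorem isLocalMin_objective_iff (hθ : IsCPWL θ) (hx : Φ x₀ ∈ effDom θ) :
    IsLocalMin (objective φ₀ Φ θ) x₀ ↔ ∀ᶠ x in 𝓝 x₀, ∀ s,
      (Φ x - Φ x₀, s) ∈ recenteredEpi θ (Φ x₀) v → lagrangian φ₀ Φ x₀ v ≤ lagrangian φ₀ Φ x v + s := by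
  obtain ⟨r, hr⟩ := hθ.exists_coe hx
  refine eventually_congr (Eventually.of_forall fun x => ?_)
  have hcancel : Φ x₀ + (Φ x - Φ x₀) = Φ x := add_sub_cancel _ _
  simp only [objective, hr]
  rcases eq_or_ne (θ (Φ x)) ⊤ with h | h
  · refine ⟨fun _ s hs => ?_, fun _ => ?_⟩
    · have := mem_effDom_of_mem_recenteredEpi hr hs
      rw [hcancel, effDom, Set.mem_ofPred_eq, h] at this
      exact absurd this (lt_irrefl _)
    · rw [h, EReal.coe_add_top]
      exact le_top
  · obtain ⟨ρ, hρ⟩ := hθ.exists_coe (lt_top_iff_ne_top.2 h)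
    have hρ' : θ (Φ x₀ + (Φ x - Φ x₀)) = ρ := by rw [hcancel, hρ]
    simp only [mem_recenteredEpi_iff hr hρ', hρ, ← EReal.coe_add, EReal.coe_le_coe_iff, lagrangian,
      inner_sub_right, real_inner_comm v]
    constructor
    · intro h1 s hs
      linarith
    · intro h1
      have := h1 (ρ - r - (⟪v, Φ x⟫ - ⟪v, Φ x₀⟫)) (by linarith)
      linarith

variable [InnerProductSpace ℝ X] [CompleteSpace X]

theorem mem_gph_solutionMapKKT_iff :
    (((0 : X), (0 : Y)), (x₀, v)) ∈ gph (solutionMapKKT φ₀ Φ θ) ↔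
      v ∈ multipliersCom φ₀ Φ θ x₀ := by
  simp [gph, solutionMapKKT, multipliersCom, eq_comm]

/-- A truly feasible point has zero violation. If its value were lower, strictness of the penalized
minimum would force `x = x₀`, and then a negative height. -/
theorem isLocalMin_of_sosc [FiniteDimensional ℝ X] [FiniteDimensional ℝ Y]
    (hθ : IsCPWL θ) (hφ₀ : ContDiffAt ℝ 2 φ₀ x₀) (hΦ : ContDiffAt ℝ 2 Φ x₀)
    (hv : v ∈ multipliersCom φ₀ Φ θ x₀) (hsosc : SOSC φ₀ Φ θ x₀ v) :
    IsLocalMin (objective φ₀ Φ θ) x₀ := by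
  obtain ⟨k, a, c, β, hE⟩ := exists_localEpi hθ hv.2
  have hS := smoothData_lagrangian hφ₀ hΦ hv.1
  have hgrow := eventually_eq_of_penalized_le hS hE fun u hu0 hu => hsosc u hu0
    (by rwa [criticalCone_eq_activeCone hθ hv.2 hE])
  rw [isLocalMin_objective_iff (v := v) hθ hv.2.1]
  obtain ⟨ρ, hρ, hball⟩ := Metric.nhds_basis_closedBall.eventually_iff.1 hgrow
  have hψc : Tendsto (fun x => lagrangian φ₀ Φ x v) (𝓝 x₀) (𝓝 (lagrangian φ₀ Φ x₀ v)) :=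
    hS.hasGradientAt.self_of_nhds.hasFDerivAt.continuousAt
  have hΦc : Tendsto (fun x => Φ x - Φ x₀) (𝓝 x₀) (𝓝 0) := by
    simpa using hS.hasFDerivAt_self.continuousAt.tendsto.sub_const (Φ x₀)
  filter_upwards [hψc.eventually (lt_mem_nhds (sub_lt_self (lagrangian φ₀ Φ x₀ v) hρ)),
    hΦc.eventually (Metric.closedBall_mem_nhds (0 : Y) hρ), Metric.closedBall_mem_nhds x₀ hρ]
    with x h1 h2 h3 s hs
  have hs0 := hE.nonneg _ hs
  simp only at hs0
  by_contra hc
  have hsρ : s ≤ ρ := by linarith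
  have h4 := hball (x := (x, Φ x - Φ x₀, s)) (by
    rw [Metric.mem_closedBall, Prod.dist_eq, Prod.dist_eq]
    refine max_le h3 (max_le h2 ?_)
    rwa [Real.dist_eq, sub_zero, abs_of_nonneg hs0]) hs (by
      simp only [add_sub_cancel, sub_self, norm_zero, add_zero]
      exact (not_le.1 hc).le)
  simp only at h4
  subst h4
  linarith

variable [CompleteSpace Y]

/-- The Lagrangian is affine in the multiplier, so shifting by `v` gives the stationarity system of
the localized model. -/
theorem eventually_mem_solutionMapKKT_iff (hθ : IsCPWL θ) (hφ₀ : ContDiffAt ℝ 2 φ₀ x₀)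
    (hΦ : ContDiffAt ℝ 2 Φ x₀) (hx : Φ x₀ ∈ effDom θ) :
    ∀ᶠ x in 𝓝 x₀, ∀ (p : X × Y) (w : Y), (x, v + w) ∈ solutionMapKKT φ₀ Φ θ p ↔
      gradLagrangian φ₀ Φ x v + (fderiv ℝ Φ x).adjoint w = p.1 ∧
        IsSubgrad (recenteredEpi θ (Φ x₀) v) (Φ x + p.2 - Φ x₀) w := by
  obtain ⟨r, hr⟩ := hθ.exists_coe hx
  have h2 : (2 : WithTop ℕ∞) ≠ ((⊤ : ℕ∞) : WithTop ℕ∞) := by decide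
  filter_upwards [hφ₀.eventually h2, hΦ.eventually h2] with x h3 h4 p w
  rw [solutionMapKKT, Set.mem_ofPred_eq, gradLagrangian_add (h3.differentiableAt (by norm_num))
    (h4.differentiableAt (by norm_num)), ← add_mem_subdiff_iff hθ hr, add_sub_cancel, eq_comm]

theorem uniqueMultiplier_of_multipliersCom_eq (hθ : IsCPWL θ) (hφ₀ : ContDiffAt ℝ 2 φ₀ x₀)
    (hΦ : ContDiffAt ℝ 2 Φ x₀) (h : multipliersCom φ₀ Φ θ x₀ = {v}) :
    UniqueMultiplier (recenteredEpi θ (Φ x₀) v) (fderiv ℝ Φ x₀) := by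
  have hv : v ∈ multipliersCom φ₀ Φ θ x₀ := by rw [h]; rfl
  intro η hη hker
  have h1 : v + η ∈ multipliersCom φ₀ Φ θ x₀ := by
    refine ⟨?_, (add_mem_subdiff_self_iff hθ hv.2).2 hη⟩
    rw [gradLagrangian_add (hφ₀.differentiableAt (by norm_num))
      (hΦ.differentiableAt (by norm_num)), hv.1, hker, add_zero]
  rw [h] at h1
  exact add_eq_left.1 h1

/-- Every point of the segment from `v` to another multiplier solves the unperturbed system, and
points close to `v` contradict isolation. -/
theorem multipliersCom_eq_of_isolatedlyCalmAt (hθ : IsCPWL θ) (hφ₀ : ContDiffAt ℝ 2 φ₀ x₀)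
    (hΦ : ContDiffAt ℝ 2 Φ x₀)
    (h : IsolatedlyCalmAt (solutionMapKKT φ₀ Φ θ) (0, 0) (x₀, v)) :
    multipliersCom φ₀ Φ θ x₀ = {v} := by
  have hv := mem_gph_solutionMapKKT_iff.1 h.1
  refine Set.Subset.antisymm (fun w hw => ?_) (Set.singleton_subset_iff.2 hv)
  obtain ⟨-, ℓ, -, U, hU, V, hV, hcalm⟩ := h
  have hφd := hφ₀.differentiableAt (two_ne_zero)
  have hΦd := hΦ.differentiableAt (two_ne_zero)
  have hdiff : (fderiv ℝ Φ x₀).adjoint (w - v) = 0 := by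
    have h1 := gradLagrangian_add hφd hΦd v (w - v)
    rw [add_sub_cancel, hw.1, hv.1, zero_add] at h1
    exact h1.symm
  have hseg : Tendsto (fun t : ℝ => (x₀, v + t • (w - v))) (𝓝[>] 0) (𝓝 (x₀, v)) :=
    tendsto_const_nhds.prodMk_nhds (tendsto_line (w - v))
  obtain ⟨t, ht, ht01⟩ := ((hseg.eventually hV).and (Ioo_mem_nhdsGT (zero_lt_one' ℝ))).exists
  have hmem : (x₀, v + t • (w - v)) ∈ solutionMapKKT φ₀ Φ θ (0, 0) := by
    refine mem_gph_solutionMapKKT_iff.2 ⟨?_, ?_⟩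
    · rw [gradLagrangian_add hφd hΦd, hv.1, map_smul, hdiff, smul_zero, add_zero]
    · have h1 := hw.2
      rw [← add_sub_cancel v w, add_mem_subdiff_self_iff hθ hv.2] at h1
      refine (add_mem_subdiff_self_iff hθ hv.2).2 fun q hq => ?_
      obtain ⟨r, hr⟩ := hθ.exists_coe hv.2.1
      have h2 := nonneg_of_mem_recenteredEpi hr hv.2 hq
      rw [real_inner_smul_left]
      nlinarith [h1 q hq, ht01.1, ht01.2]
  have h3 := hcalm (0, 0) (mem_of_mem_nhds hU) ⟨hmem, ht⟩
  rw [sub_self, norm_zero, mul_zero, Metric.closedBall_zero, Set.mem_singleton_iff,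
    Prod.mk.injEq] at h3
  have h4 : t • (w - v) = 0 := add_eq_left.1 h3.2
  exact sub_eq_zero.1 ((smul_eq_zero.1 h4).resolve_left ht01.1.ne')

theorem eventually_calm_of_isolatedlyCalmAt (hθ : IsCPWL θ) (hφ₀ : ContDiffAt ℝ 2 φ₀ x₀)
    (hΦ : ContDiffAt ℝ 2 Φ x₀) (hx : Φ x₀ ∈ effDom θ)
    (h : IsolatedlyCalmAt (solutionMapKKT φ₀ Φ θ) (0, 0) (x₀, v)) :
    ∃ ℓ : ℝ, ∀ᶠ w : (X × Y) × (X × Y) in 𝓝 ((0, 0), (x₀, 0)),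
      gradLagrangian φ₀ Φ w.2.1 v + (fderiv ℝ Φ w.2.1).adjoint w.2.2 = w.1.1 →
      IsSubgrad (recenteredEpi θ (Φ x₀) v) (Φ w.2.1 + w.1.2 - Φ x₀) w.2.2 →
        ‖(w.2.1 - x₀, w.2.2)‖ ≤ ℓ * ‖w.1‖ := by
  obtain ⟨-, ℓ, -, U, hU, V, hV, hcalm⟩ := h
  refine ⟨ℓ, ?_⟩
  have hp : Tendsto (fun w : (X × Y) × (X × Y) => w.1) (𝓝 ((0, 0), (x₀, 0))) (𝓝 (0, 0)) :=
    continuous_fst.tendsto _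
  have hq : Tendsto (fun w : (X × Y) × (X × Y) => (w.2.1, v + w.2.2)) (𝓝 ((0, 0), (x₀, 0)))
      (𝓝 (x₀, v)) := by
    have : Continuous fun w : (X × Y) × (X × Y) => (w.2.1, v + w.2.2) := by fun_prop
    simpa using this.tendsto ((0, 0), (x₀, 0))
  have hx' : Tendsto (fun w : (X × Y) × (X × Y) => w.2.1) (𝓝 ((0, 0), (x₀, 0))) (𝓝 x₀) :=
    (continuous_fst.comp continuous_snd).tendsto _
  filter_upwards [hp.eventually hU, hq.eventually hV,
    hx'.eventually (eventually_mem_solutionMapKKT_iff (v := v) hθ hφ₀ hΦ hx)] with w h1 h2 h3 h4 h5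
  have h6 := hcalm w.1 h1 ⟨(h3 w.1 w.2.2).2 ⟨h4, h5⟩, h2⟩
  rw [mem_closedBall_iff_norm] at h6
  have h7 : ((w.2.1, v + w.2.2) : X × Y) - (x₀, v) = (w.2.1 - x₀, w.2.2) := by
    ext <;> simp
  have h8 : w.1 - ((0 : X), (0 : Y)) = w.1 := sub_zero _
  rwa [h7, h8] at h6

theorem isNoncriticalMultiplier_of_isolatedlyCalmAt [FiniteDimensional ℝ X]
    (hθ : IsCPWL θ) (hφ₀ : ContDiffAt ℝ 2 φ₀ x₀) (hΦ : ContDiffAt ℝ 2 Φ x₀)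
    (h : IsolatedlyCalmAt (solutionMapKKT φ₀ Φ θ) (0, 0) (x₀, v)) :
    IsNoncriticalMultiplier (gradLagrangian φ₀ Φ) Φ θ x₀ v := by
  have hv := mem_gph_solutionMapKKT_iff.1 h.1
  obtain ⟨r, hr⟩ := hθ.exists_coe hv.2.1
  refine ⟨hv, ?_⟩
  rintro ⟨-, ξ, hξ, η, hη, heq⟩
  obtain ⟨ℓ, hℓ⟩ := eventually_calm_of_isolatedlyCalmAt hθ hφ₀ hΦ hv.2.1 h
  obtain ⟨α, l, hl, t, D, htpos, ht, hmem, hlim⟩ := exists_steps_of_mem_tangentConeAt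
    (S := gph (subdiff θ)) (z := (Φ x₀, v)) hv.2 hη
  refine hξ (eq_zero_of_calm (smoothData_lagrangian hφ₀ hΦ hv.1) hℓ heq.symm htpos ht
    (hmem.mono fun k hk => ?_) hlim)
  exact (add_mem_subdiff_iff hθ hr).1 hk

theorem sosc_of_isNoncriticalMultiplier [FiniteDimensional ℝ X] [FiniteDimensional ℝ Y]
    (hθ : IsCPWL θ) (hφ₀ : ContDiffAt ℝ 2 φ₀ x₀) (hΦ : ContDiffAt ℝ 2 Φ x₀)
    (hU : multipliersCom φ₀ Φ θ x₀ = {v}) (hmin : IsLocalMin (objective φ₀ Φ θ) x₀)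
    (hnc : IsNoncriticalMultiplier (gradLagrangian φ₀ Φ) Φ θ x₀ v) : SOSC φ₀ Φ θ x₀ v := by
  have hv : v ∈ multipliersCom φ₀ Φ θ x₀ := hnc.1
  obtain ⟨r, hr⟩ := hθ.exists_coe hv.2.1
  obtain ⟨k, a, c, β, hE⟩ := exists_localEpi hθ hv.2
  intro u hu0 hu
  rw [criticalCone_eq_activeCone hθ hv.2 hE] at hu
  refine inner_hess_pos_of_noncritical (smoothData_lagrangian hφ₀ hΦ hv.1) hE
    (uniqueMultiplier_of_multipliersCom_eq hθ hφ₀ hΦ hU)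
    ((isLocalMin_objective_iff hθ hv.2.1).1 hmin) (fun ξ η heq hev => ?_) hu0 hu
  by_contra hξ
  refine hnc.2 ⟨hv, ξ, hξ, η, ?_, heq.symm⟩
  -- An initial piece of the ray through `(∇Φ(x₀) ξ, η)` lies in the translated graph, so the
  -- direction is tangent.
  refine mem_tangentConeAt_of_seq (𝓝[>] (0 : ℝ)) (fun t => (t⁻¹).toNNReal)
    (fun t => t • (fderiv ℝ Φ x₀ ξ, η)) ?_ ?_ ?_
  · simpa using tendsto_line (x₀ := (0 : Y × Y)) (fderiv ℝ Φ x₀ ξ, η)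
  · filter_upwards [hev] with t ht using (add_mem_subdiff_iff hθ hr).2 ht
  · refine tendsto_const_nhds.congr' ?_
    filter_upwards [self_mem_nhdsWithin] with t ht
    rw [NNReal.smul_def, Real.coe_toNNReal _ (inv_nonneg.2 (le_of_lt ht)),
      inv_smul_smul₀ (ne_of_gt ht)]

theorem robustlyIsolatedlyCalmAt_of_sosc [FiniteDimensional ℝ X] [FiniteDimensional ℝ Y]
    (hθ : IsCPWL θ) (hφ₀ : ContDiffAt ℝ 2 φ₀ x₀) (hΦ : ContDiffAt ℝ 2 Φ x₀)
    (hU : multipliersCom φ₀ Φ θ x₀ = {v}) (hsosc : SOSC φ₀ Φ θ x₀ v) :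
    RobustlyIsolatedlyCalmAt (solutionMapKKT φ₀ Φ θ) (0, 0) (x₀, v) := by
  have hv : v ∈ multipliersCom φ₀ Φ θ x₀ := by rw [hU]; rfl
  obtain ⟨k, a, c, β, hE⟩ := exists_localEpi hθ hv.2
  have hS := smoothData_lagrangian hφ₀ hΦ hv.1
  have hUM := uniqueMultiplier_of_multipliersCom_eq hθ hφ₀ hΦ hU
  have hsosc' : ∀ u, u ≠ 0 → fderiv ℝ Φ x₀ u ∈ activeCone a β →
      0 < ⟪hessLagrangian φ₀ Φ x₀ v u, u⟫ := fun u hu0 hu => hsosc u hu0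
    (by rwa [criticalCone_eq_activeCone hθ hv.2 hE])
  obtain ⟨ℓ, hℓ, hcalm⟩ := exists_calm_of_sosc hS hE hUM hsosc'
  have hgrow := eventually_eq_of_penalized_le hS hE hsosc'
  rw [nhds_prod_eq, Metric.nhds_basis_closedBall.prod Metric.nhds_basis_closedBall
    |>.eventually_iff] at hcalm
  obtain ⟨⟨ρ₁, ρ₂⟩, ⟨hρ₁, hρ₂⟩, hcalm⟩ := hcalm
  obtain ⟨ρ₃, hρ₃, hiff⟩ := Metric.nhds_basis_closedBall.eventually_iff.1
    (eventually_mem_solutionMapKKT_iff (v := v) hθ hφ₀ hΦ hv.2.1)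
  -- `ρ₂` keeps solutions where the calmness estimate holds, `ρ₃` where the KKT system is equivalent
  -- to the model.
  set ρ := min ρ₂ ρ₃ with hρdef
  have hρ : 0 < ρ := lt_min hρ₂ hρ₃
  have hex := eventually_exists_stationary hS hE hUM hgrow hρ
  refine ⟨mem_gph_solutionMapKKT_iff.2 hv, ℓ, hℓ, _,
    inter_mem (Metric.closedBall_mem_nhds ((0 : X), (0 : Y)) hρ₁) hex,
    Metric.closedBall (x₀, v) ρ, Metric.closedBall_mem_nhds _ hρ, ?_⟩
  rintro p ⟨hp₁, x, w, hx, hw, hgrad, hsub⟩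
  constructor
  · rintro ⟨x', v'⟩ ⟨hq, hqρ⟩
    rw [mem_closedBall_iff_norm] at hqρ ⊢
    have hqρ₁ : ‖x' - x₀‖ ≤ ρ := (norm_fst_le _).trans hqρ
    have hqρ₂ : ‖v' - v‖ ≤ ρ := (norm_snd_le _).trans hqρ
    rw [← add_sub_cancel v v'] at hq
    obtain ⟨h1, h2⟩ := (hiff (x := x') (by
      rw [mem_closedBall_iff_norm]; exact hqρ₁.trans (min_le_right _ _)) p (v' - v)).1 hq
    have h3 := hcalm (x := (p, (x', v' - v))) ⟨hp₁, by
      rw [mem_closedBall_iff_norm]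
      refine (norm_prod_le_iff.2 ⟨hqρ₁, ?_⟩).trans (min_le_left ρ₂ ρ₃)
      change ‖v' - v - 0‖ ≤ _
      rwa [sub_zero]⟩ h1 h2
    have h4 : p - ((0 : X), (0 : Y)) = p := sub_zero _
    rw [h4]
    exact h3
  · refine ⟨(x, v + w), ?_, ?_⟩
    · exact (hiff (by rw [mem_closedBall_iff_norm]; exact hx.trans (min_le_right _ _)) p w).2
        ⟨hgrad, hsub⟩
    · rw [mem_closedBall_iff_norm]
      refine norm_prod_le_iff.2 ⟨hx, ?_⟩
      simpa using hw

end Composite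

end CompositeOpt

/-! ### The cycle of implications. -/

theorem theorem7p5 {n m : ℕ}
    (φ₀ : EuclideanSpace ℝ (Fin n) → ℝ)
    (Φ : EuclideanSpace ℝ (Fin n) → EuclideanSpace ℝ (Fin m))
    (θ : EuclideanSpace ℝ (Fin m) → EReal)
    (x : EuclideanSpace ℝ (Fin n)) (v : EuclideanSpace ℝ (Fin m))
    (hθ : CompositeOpt.IsCPWL θ)
    (hφ₀ : ContDiffAt ℝ 2 φ₀ x) (hΦ : ContDiffAt ℝ 2 Φ x)
    (hx : Φ x ∈ CompositeOpt.effDom θ) :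
    List.TFAE [
      CompositeOpt.RobustlyIsolatedlyCalmAt
          (CompositeOpt.solutionMapKKT φ₀ Φ θ) (0, 0) (x, v) ∧
        IsLocalMin (CompositeOpt.objective φ₀ Φ θ) x,
      CompositeOpt.SOSC φ₀ Φ θ x v ∧ CompositeOpt.multipliersCom φ₀ Φ θ x = {v},
      CompositeOpt.multipliersCom φ₀ Φ θ x = {v} ∧
        IsLocalMin (CompositeOpt.objective φ₀ Φ θ) x ∧
        CompositeOpt.IsNoncriticalMultiplier (CompositeOpt.gradLagrangian φ₀ Φ) Φ θ x v,
      CompositeOpt.IsolatedlyCalmAt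
          (CompositeOpt.solutionMapKKT φ₀ Φ θ) (0, 0) (x, v) ∧
        IsLocalMin (CompositeOpt.objective φ₀ Φ θ) x] := by
  tfae_have 1 → 4 := by
    rintro ⟨⟨hgph, ℓ, hℓ, U, hU, V, hV, h⟩, hmin⟩
    exact ⟨⟨hgph, ℓ, hℓ, U, hU, V, hV, fun p hp => (h p hp).1⟩, hmin⟩
  tfae_have 4 → 3 := fun ⟨hcalm, hmin⟩ =>
    ⟨CompositeOpt.multipliersCom_eq_of_isolatedlyCalmAt hθ hφ₀ hΦ hcalm, hmin,
      CompositeOpt.isNoncriticalMultiplier_of_isolatedlyCalmAt hθ hφ₀ hΦ hcalm⟩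
  tfae_have 3 → 2 := fun ⟨hU, hmin, hnc⟩ =>
    ⟨CompositeOpt.sosc_of_isNoncriticalMultiplier hθ hφ₀ hΦ hU hmin hnc, hU⟩
  tfae_have 2 → 1 := fun ⟨hsosc, hU⟩ =>
    ⟨CompositeOpt.robustlyIsolatedlyCalmAt_of_sosc hθ hφ₀ hΦ hU hsosc,
      CompositeOpt.isLocalMin_of_sosc hθ hφ₀ hΦ (hU ▸ Set.mem_singleton v) hsosc⟩
  tfae_finish
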